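/- Let $n\ge 2$ and $m\ge 4$ be integers and let $\mathbf p=(p_x)_{1\le x\le m}$ be a probability mass function on $\{1,\dots,m\}$ with $p_x>0$ for all $x$. Let $X_1,\dots,X_n$ be independent random variables, each with probability mass function $\mathbf p$ (ball $i$ is placed in urn $X_i$). Put $$M_i=-1+\sum_{j=1}^n \mathbf 1\{X_j=X_i\},\qquad Y=\sum_{i=1}^n \mathbf 1\{M_i>0\},$$ so that $Y$ is the number of non-isolated balls. Let $\mu_Y$ and $\sigma_Y$ be the mean and the standard deviation of $Y$. Then $\sigma_Y>0$, and with $$D_Y=\sup_{t\in\mathbb R}\left|P\left[\frac{Y-\mu_Y}{\sigma_Y}\le t\right]-\Phi(t)\right|,$$ where $\Phi$ is the standard normal distribution function, one has $$D_Y\ \ge\ \min\left(\tfrac16,\ (8\pi e)^{-1/2}\sigma_Y^{-1}\right).$$ Moreover, let $\|\mathbf p\|=\max_x p_x$ and $\gamma=\max(n\|\mathbf p\|,1)$. If $$\|\mathbf p\|\le \tfrac1{11}\qquad\text{and}\qquad n\ \ge\ 83\,\gamma^2(1+3\gamma+3\gamma^2)\,e^{1.05\gamma},$$ then $$D_Y\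 \le\ 8165\,\gamma^2 e^{2.1\gamma}\,\bigl(577+23\,C(\gamma)\bigr)\,\sigma_Y^{-1},$$ where $$C(\gamma)=10\,\bigl(82\gamma^7+82\gamma^6+80\gamma^5+47\gamma^4+12\gamma^3+12\gamma^2\bigr)^{1/2}.$$ -/

import Mathlib

open MeasureTheory ProbabilityTheory

noncomputable section

namespace UrnModel

/-- `M_i = -1 + ∑_j 1{X_j = X_i}`: the number of other balls in the urn of ball `i`,
for an allocation `x` of `n` balls to `m` urns. -/
def companions {n m : ℕ} (x : Fin n → Fin m) (i : Fin n) : ℤ :=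
  -1 + ∑ j : Fin n, if x j = x i then 1 else 0

/-- `Y = ∑_i 1{M_i > 0}`: the number of non-isolated balls. -/
def nonIsolated {n m : ℕ} {Ω : Type*} (X : Fin n → Ω → Fin m) (ω : Ω) : ℝ :=
  ∑ i : Fin n, if 0 < companions (fun j => X j ω) i then 1 else 0

/-- The standard deviation of a real random variable. -/
def stdDev {Ω : Type*} [MeasurableSpace Ω] (W : Ω → ℝ) (P : Measure Ω) : ℝ :=
  Real.sqrt (variance W P)

/-- The Kolmogorov distance `D_W` between the standardisation of `W` and the standard normal
law (used only when the standard deviation of `W` is positive). -/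
def kolmogorovDist {Ω : Type*} [MeasurableSpace Ω] (W : Ω → ℝ) (P : Measure Ω) : ℝ :=
  ⨆ t : ℝ, |P.real {ω | (W ω - ∫ ω', W ω' ∂P) / stdDev W P ≤ t} - cdf (gaussianReal 0 1) t|

/-- The largest urn probability. -/
def maxProb {m : ℕ} (p : Fin m → ℝ) : ℝ := ⨆ x : Fin m, p x

/-- `γ = max (n ‖p‖, 1)`. -/
def gam (n : ℕ) {m : ℕ} (p : Fin m → ℝ) : ℝ := max (n * maxProb p) 1

/-- The function `C(γ)`. -/
def Cfun (γ : ℝ) : ℝ :=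
  10 * Real.sqrt (82 * γ ^ 7 + 82 * γ ^ 6 + 80 * γ ^ 5 + 47 * γ ^ 4 + 12 * γ ^ 3 + 12 * γ ^ 2)

end UrnModel

end

/-! Upper bound: Stein's method, through a covariance identity with bounded increments. The
indicator that ball i, once placed in urn b, meets another ball equals its mean plus a sum of terms,
each carrying the centred indicator of one ball (`occupied_eq`). Resampling that ball turns each
term into a difference, so that E[(Y - μ) f(Y)] = E ∑ g_k (f(Y after move k) - f(Y before move k)).
The weights g_k are nonnegative with sum at most 2λ, where λ = n² ∑ p_b², and a move changes Y by at
most 2 (`expect_nonIso_sub_mul`). With f the identity, T = ∑ g_k ΔY_k has mean σ². With f the Stein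
solution for a smoothed indicator, two errors remain: the fluctuation of T, of size √(Var T)/σ², and
a first-order remainder involving the probability that W = (Y - μ)/σ falls in a short window. That
probability is at most 2D plus a Gaussian increment, where D bounds the Kolmogorov distance.
Choosing the smoothing width proportional to λ/σ³ gives D/2 + O(·) on the right, and D is absorbed
(`kolmogorov_le_of_increments`).

Two estimates feed this. Var T = O(γ³ λ) follows from Efron–Stein, because relocating one ball
alters few increments (`variance_driftSum_le`). The bound λ ≤ 135 e^{2.1γ} σ² comes from
Cauchy–Schwarz for Y against symmetric polynomials of degree r in the centred urn indicators. Their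
covariance with Y is explicit and dominated by diagonal terms proportional to n p_z - r; as such a
factor may vanish, r = 2 and r = 3 are combined (`variance_nonIso_ge`).

Lower bound: Y is an integer, so its distribution function is flat between lattice points while Φ
grows across each cell of length 1/σ; half of that growth bounds D from below
(`min_le_of_kolmogorov`). -/

noncomputable section

set_option linter.unusedSectionVars false

namespace UrnModel

open Function

/-! ### Product expectations and the Efron–Stein inequality -/

section Expect

variable {ι α : Type*} [Fintype ι] [DecidableEq ι] [Fintype α] [DecidableEq α]

/-- The expectation of `g` when the coordinates are independent with mass function `p`. -/
def expect (p : α → ℝ) (g : (ι → α) → ℝ) : ℝ := ∑ x, (∏ i, p (x i)) * g x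

variable {p : α → ℝ}

lemma expect_add (g h : (ι → α) → ℝ) :
    expect p (fun x => g x + h x) = expect p g + expect p h := by
  simp [expect, mul_add, Finset.sum_add_distrib]

lemma expect_sub (g h : (ι → α) → ℝ) :
    expect p (fun x => g x - h x) = expect p g - expect p h := by
  simp [expect, mul_sub, Finset.sum_sub_distrib]

lemma expect_mul_left (c : ℝ) (g : (ι → α) → ℝ) :
    expect p (fun x => c * g x) = c * expect p g := by
  simp only [expect, Finset.mul_sum]
  exact Finset.sum_congr rfl fun x _ => by ring

lemma expect_mul_right (c : ℝ) (g : (ι → α) → ℝ) :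
    expect p (fun x => g x * c) = expect p g * c := by
  simp only [expect, Finset.sum_mul]
  exact Finset.sum_congr rfl fun x _ => by ring

lemma expect_sum {κ : Type*} (s : Finset κ) (g : κ → (ι → α) → ℝ) :
    expect p (fun x => ∑ k ∈ s, g k x) = ∑ k ∈ s, expect p (g k) := by
  simp only [expect, Finset.mul_sum]
  exact Finset.sum_comm

lemma expect_prod (g : ι → α → ℝ) :
    expect p (fun x => ∏ i, g i (x i)) = ∏ i, ∑ v, p v * g i v := by
  rw [Finset.prod_univ_sum, Fintype.piFinset_univ]
  exact Finset.sum_congr rfl fun x _ => by rw [Finset.prod_mul_distrib]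

lemma expect_const (h1 : ∑ v, p v = 1) (c : ℝ) : expect p (fun _ : ι → α => c) = c := by
  have h := expect_prod (ι := ι) (p := p) (fun _ _ => 1)
  simp only [Finset.prod_const_one, mul_one, h1] at h
  have h2 := expect_mul_left (p := p) c (fun _ : ι → α => 1)
  simpa [h] using h2

lemma expect_mono (h0 : ∀ v, 0 ≤ p v) {g h : (ι → α) → ℝ} (hgh : ∀ x, g x ≤ h x) :
    expect p g ≤ expect p h :=
  Finset.sum_le_sum fun x _ =>
    mul_le_mul_of_nonneg_left (hgh x) (Finset.prod_nonneg fun _ _ => h0 _)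

lemma expect_nonneg (h0 : ∀ v, 0 ≤ p v) {g : (ι → α) → ℝ} (hg : ∀ x, 0 ≤ g x) :
    0 ≤ expect p g :=
  Finset.sum_nonneg fun x _ => mul_nonneg (Finset.prod_nonneg fun _ _ => h0 _) (hg x)

lemma abs_expect_le (h0 : ∀ v, 0 ≤ p v) (g : (ι → α) → ℝ) :
    |expect p g| ≤ expect p (fun x => |g x|) := by
  refine (Finset.abs_sum_le_sum_abs _ _).trans (Finset.sum_le_sum fun x _ => ?_)
  rw [abs_mul, abs_of_nonneg (Finset.prod_nonneg fun _ _ => h0 _)]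

/-- Cauchy–Schwarz for `expect`. -/
lemma expect_mul_sq_le (h0 : ∀ v, 0 ≤ p v) (g h : (ι → α) → ℝ) :
    expect p (fun x => g x * h x) ^ 2 ≤
      expect p (fun x => g x ^ 2) * expect p (fun x => h x ^ 2) := by
  have hw : ∀ x : ι → α, 0 ≤ ∏ i, p (x i) := fun x => Finset.prod_nonneg fun _ _ => h0 _
  refine Finset.sum_sq_le_sum_mul_sum_of_sq_le_mul _ (fun x _ => mul_nonneg (hw x) (sq_nonneg _))
    (fun x _ => mul_nonneg (hw x) (sq_nonneg _)) (fun x _ => le_of_eq (by ring))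

lemma sq_expect_le (h0 : ∀ v, 0 ≤ p v) (h1 : ∑ v, p v = 1) (g : (ι → α) → ℝ) :
    expect p g ^ 2 ≤ expect p (fun x => g x ^ 2) := by
  have h := expect_mul_sq_le h0 g (fun _ => 1)
  simpa [expect_const h1] using h

lemma sq_sum_mul_le (h0 : ∀ v, 0 ≤ p v) (h1 : ∑ v, p v = 1) (g : α → ℝ) :
    (∑ v, p v * g v) ^ 2 ≤ ∑ v, p v * g v ^ 2 := by
  have h := Finset.sum_sq_le_sum_mul_sum_of_sq_le_mul (R := ℝ) Finset.univ
    (r := fun v => p v * g v) (f := p) (g := fun v => p v * g v ^ 2)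
    (fun v _ => h0 v) (fun v _ => mul_nonneg (h0 v) (sq_nonneg _)) (fun v _ => le_of_eq (by ring))
  simpa [h1] using h

/-- Averaging over the coordinate `i`. -/
def average (p : α → ℝ) (i : ι) (g : (ι → α) → ℝ) (x : ι → α) : ℝ := ∑ v, p v * g (update x i v)

/-- Swapping the coordinate `i` of the first component with the second component. -/
def swapCoord (i : ι) : ((ι → α) × α) ≃ ((ι → α) × α) where
  toFun z := (update z.1 i z.2, z.1 i)
  invFun z := (update z.1 i z.2, z.1 i)
  left_inv z := by simp
  right_inv z := by simp

lemma weight_update (i : ι) (x : ι → α) (v : α) :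
    (∏ j, p (update x i v j)) * p (x i) = (∏ j, p (x j)) * p v := by
  rw [← Finset.mul_prod_erase _ _ (Finset.mem_univ i),
    ← Finset.mul_prod_erase _ (fun j => p (x j)) (Finset.mem_univ i)]
  have : ∏ j ∈ Finset.univ.erase i, p (update x i v j) = ∏ j ∈ Finset.univ.erase i, p (x j) :=
    Finset.prod_congr rfl fun j hj => by rw [update_of_ne (Finset.ne_of_mem_erase hj)]
  rw [this, update_self]
  ring

/-- Exchanging x_i with an independent copy v preserves the product weight on pairs (x, v) and turns
g(`update x i v`) into g(x). -/
lemma expect_average (h1 : ∑ v, p v = 1) (i : ι) (g : (ι → α) → ℝ) :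
    expect p (average p i g) = expect p g := by
  have e : ∑ z : (ι → α) × α, (∏ j, p (z.1 j)) * p z.2 * g (update z.1 i z.2)
      = ∑ z : (ι → α) × α, (∏ j, p (z.1 j)) * p z.2 * g z.1 := by
    rw [← (swapCoord (α := α) i).sum_comp]
    refine Finset.sum_congr rfl fun z _ => ?_
    simp only [swapCoord, Equiv.coe_fn_mk, update_idem, update_eq_self]
    rw [weight_update]
  rw [Fintype.sum_prod_type, Fintype.sum_prod_type] at e
  simp only [expect, average, Finset.mul_sum]
  simp only [mul_assoc] at e
  rw [e]
  refine Finset.sum_congr rfl fun x _ => ?_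
  rw [← Finset.mul_sum, ← Finset.sum_mul, h1, one_mul]

lemma expect_resample (h1 : ∑ v, p v = 1) (i : ι) (g : (ι → α) → ℝ) :
    expect p g = ∑ v, p v * expect p (fun x => g (update x i v)) := by
  rw [← expect_average h1 i]
  unfold average
  rw [expect_sum]
  simp only [expect_mul_left]

lemma expect_indicator_mul (h1 : ∑ v, p v = 1) (i : ι) (v : α) (g : (ι → α) → ℝ) :
    expect p (fun x => (if x i = v then 1 else 0) * g x) =
      p v * expect p (fun x => g (update x i v)) := by
  rw [expect_resample h1 i]
  simp only [update_self]
  rw [Finset.sum_eq_single v]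
  · simp
  · intro u _ hu
    simp [hu, expect]
  · simp

lemma average_comm (i j : ι) (g : (ι → α) → ℝ) (x : ι → α) :
    average p i (average p j g) x = average p j (average p i g) x := by
  by_cases hij : i = j
  · rw [hij]
  simp only [average, Finset.mul_sum]
  rw [Finset.sum_comm]
  refine Finset.sum_congr rfl fun v _ => Finset.sum_congr rfl fun u _ => ?_
  rw [update_comm hij]
  ring

lemma average_sub (i : ι) (g h : (ι → α) → ℝ) (x : ι → α) :
    average p i (fun y => g y - h y) x = average p i g x - average p i h x := by
  simp [average, mul_sub, Finset.sum_sub_distrib]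

lemma average_update (i : ι) (g : (ι → α) → ℝ) (x : ι → α) (v : α) :
    average p i g (update x i v) = average p i g x := by
  simp [average]

lemma expect_average_sq_le (h0 : ∀ v, 0 ≤ p v) (h1 : ∑ v, p v = 1) (i : ι) (g : (ι → α) → ℝ) :
    expect p (fun x => average p i g x ^ 2) ≤ expect p (fun x => g x ^ 2) := by
  rw [← expect_average h1 i (fun x => g x ^ 2)]
  exact expect_mono h0 fun x => sq_sum_mul_le h0 h1 _

/-- Pythagoras: averaging over one coordinate is an orthogonal projection in L². -/
lemma expect_sq_sub_average (h1 : ∑ v, p v = 1) (i : ι) (g : (ι → α) → ℝ) :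
    expect p (fun x => (g x - average p i g x) ^ 2) =
      expect p (fun x => g x ^ 2) - expect p (fun x => average p i g x ^ 2) := by
  have h : expect p (fun x => g x * average p i g x) = expect p (fun x => average p i g x ^ 2) := by
    rw [← expect_average h1 i]
    congr 1
    funext x
    simp only [average, update_idem]
    rw [sq, Finset.sum_mul]
    exact Finset.sum_congr rfl fun v _ => by ring
  have e : (fun x => (g x - average p i g x) ^ 2) = fun x : ι → α =>
      g x ^ 2 - (2 * (g x * average p i g x) - average p i g x ^ 2) := by
    funext x; ring
  rw [e, expect_sub, expect_sub, expect_mul_left, h]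
  ring

lemma eq_of_update_invariant {g : (ι → α) → ℝ} (hg : ∀ i x v, g (update x i v) = g x)
    (x y : ι → α) : g x = g y := by
  have h : ∀ s : Finset ι, g (s.piecewise y x) = g x := by
    intro s
    induction s using Finset.induction_on with
    | empty => simp
    | insert k s _ ih => rw [Finset.piecewise_insert, hg, ih]
  simpa using (h Finset.univ).symm

/-- Coordinates are averaged out one at a time. Averaging over k lowers the second moment by exactly
E(f - A_k f)², and this is at most the same quantity for the original g because the averages commute
and contract in L². -/
lemma exists_partial_average (h0 : ∀ v, 0 ≤ p v) (h1 : ∑ v, p v = 1) (g : (ι → α) → ℝ)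
    (s : Finset ι) : ∃ f : (ι → α) → ℝ, expect p f = expect p g ∧
      (∀ i ∈ s, ∀ x v, f (update x i v) = f x) ∧
      (∀ i, expect p (fun x => (f x - average p i f x) ^ 2) ≤
        expect p (fun x => (g x - average p i g x) ^ 2)) ∧
      expect p (fun x => g x ^ 2) - expect p (fun x => f x ^ 2) ≤
        ∑ i ∈ s, expect p (fun x => (g x - average p i g x) ^ 2) := by
  induction s using Finset.induction_on with
  | empty => exact ⟨g, rfl, by simp, fun i => le_rfl, by simp⟩
  | insert k s hk ih =>
    obtain ⟨f, hf1, hf2, hf3, hf4⟩ := ih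
    refine ⟨average p k f, by rw [expect_average h1, hf1], ?_, ?_, ?_⟩
    · intro i hi x v
      by_cases hik : i = k
      · rw [hik, average_update]
      · have his : i ∈ s := by simpa [hik] using hi
        simp only [average]
        refine Finset.sum_congr rfl fun u _ => ?_
        rw [update_comm hik, hf2 i his]
    · intro i
      refine le_trans ?_ (hf3 i)
      have e : ∀ x, average p k f x - average p i (average p k f) x =
          average p k (fun y => f y - average p i f y) x := by
        intro x
        rw [average_sub, average_comm]
      simp only [e]
      exact expect_average_sq_le h0 h1 _ _
    · rw [Finset.sum_insert hk]
      have := hf3 k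
      rw [expect_sq_sub_average h1] at this
      linarith

/-- The Efron–Stein inequality. -/
theorem efron_stein (h0 : ∀ v, 0 ≤ p v) (h1 : ∑ v, p v = 1) (g : (ι → α) → ℝ) :
    expect p (fun x => (g x - expect p g) ^ 2) ≤
      ∑ i, ∑ v, p v * expect p (fun x => (g x - g (update x i v)) ^ 2) := by
  obtain ⟨f, hf1, hf2, -, hf4⟩ := exists_partial_average h0 h1 g Finset.univ
  have hc : ∀ x, f x = expect p g := by
    intro x
    rw [← hf1]
    have : f = fun _ => f x :=
      funext fun y => eq_of_update_invariant (fun i => hf2 i (Finset.mem_univ i)) y x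
    rw [this, expect_const h1]
  have hv : expect p (fun x => (g x - expect p g) ^ 2) =
      expect p (fun x => g x ^ 2) - expect p g ^ 2 := by
    have e : (fun x => (g x - expect p g) ^ 2) = fun x : ι → α =>
        g x ^ 2 - (2 * expect p g * g x - expect p g ^ 2) := by
      funext x; ring
    rw [e, expect_sub, expect_sub, expect_mul_left, expect_const h1]
    ring
  rw [hv]
  simp only [hc, expect_const h1] at hf4
  refine hf4.trans (Finset.sum_le_sum fun i _ => ?_)
  rw [← Finset.sum_congr rfl fun v _ => expect_mul_left (p v) _, ← expect_sum]
  refine expect_mono h0 fun x => ?_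
  -- Jensen in the resampled value v; the classical factor 1/2 is given away.
  have e : g x - average p i g x = ∑ v, p v * (g x - g (update x i v)) := by
    simp only [average, mul_sub, Finset.sum_sub_distrib, ← Finset.sum_mul, h1, one_mul]
  rw [e]
  exact sq_sum_mul_le h0 h1 _

end Expect

/-! ### The Stein equation for the standard normal law -/

section Stein

open Set Real

lemma integrable_exp_neg_sq_half : Integrable (fun u : ℝ => exp (-u ^ 2 / 2)) := by
  have h := integrable_exp_neg_mul_sq (b := 1 / 2) (by norm_num)
  refine h.congr (Filter.Eventually.of_forall fun u => ?_)
  simp only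
  congr 1; ring

lemma gaussianPDFReal_std (u : ℝ) :
    gaussianPDFReal 0 1 u = (√(2 * π))⁻¹ * exp (-u ^ 2 / 2) := by
  simp [gaussianPDFReal_def]

lemma sqrt_two_pi_le : √(2 * π) ≤ 2.51 := by
  rw [Real.sqrt_le_left (by norm_num)]
  nlinarith [pi_lt_d2]

lemma two_le_sqrt_two_pi : 2 ≤ √(2 * π) := by
  apply Real.le_sqrt_of_sq_le
  nlinarith [pi_gt_three]

lemma integral_Ioi_mul_exp (w : ℝ) :
    IntegrableOn (fun u : ℝ => u * exp (-u ^ 2 / 2)) (Ioi w) ∧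
      ∫ u in Ioi w, u * exp (-u ^ 2 / 2) = exp (-w ^ 2 / 2) := by
  have hi : Integrable (fun u : ℝ => u * exp (-u ^ 2 / 2)) := by
    have h := integrable_mul_exp_neg_mul_sq (b := 1 / 2) (by norm_num)
    refine h.congr (Filter.Eventually.of_forall fun u => ?_)
    simp only
    congr 2; ring
  refine ⟨hi.integrableOn, ?_⟩
  have hd : ∀ x ∈ Ici w, HasDerivAt (fun u : ℝ => -exp (-u ^ 2 / 2)) (x * exp (-x ^ 2 / 2)) x := by
    intro x _
    have h1 : HasDerivAt (fun u : ℝ => -u ^ 2 / 2) (-x) x := by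
      exact (((hasDerivAt_pow 2 x).neg).div_const 2).congr_deriv (by norm_num; ring)
    exact h1.exp.neg.congr_deriv (by ring)
  have ht : Filter.Tendsto (fun u : ℝ => -exp (-u ^ 2 / 2)) Filter.atTop (nhds (-0)) := by
    apply Filter.Tendsto.neg
    apply tendsto_exp_atBot.comp
    have : Filter.Tendsto (fun u : ℝ => u ^ 2 / 2) Filter.atTop Filter.atTop :=
      (Filter.tendsto_pow_atTop two_ne_zero).atTop_div_const (by norm_num)
    refine (Filter.tendsto_neg_atTop_atBot.comp this).congr fun u => ?_
    simp only [Function.comp]; ring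
  rw [integral_Ioi_of_hasDerivAt_of_tendsto' hd hi.integrableOn ht]
  ring

lemma mul_gaussian_tail_le (w : ℝ) :
    w * ∫ u in Ioi w, exp (-u ^ 2 / 2) ≤ exp (-w ^ 2 / 2) := by
  obtain ⟨hi, he⟩ := integral_Ioi_mul_exp w
  rw [← he, ← integral_const_mul]
  refine setIntegral_mono_on (integrable_exp_neg_sq_half.integrableOn.const_mul w) hi
    measurableSet_Ioi fun u hu => ?_
  exact mul_le_mul_of_nonneg_right (le_of_lt hu) (exp_pos _).le

lemma gaussian_tail_nonneg (w : ℝ) : 0 ≤ ∫ u in Ioi w, exp (-u ^ 2 / 2) :=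
  integral_nonneg fun _ => (exp_pos _).le

/-- For w ≥ 1 this is Mills' bound. For w < 1 the tail is at most √(2π)/2 ≤ 1.255, while exp(-w²/2)
≥ 1/2, so the constant 3 suffices. -/
lemma gaussian_tail_le {w : ℝ} (hw : 0 ≤ w) :
    ∫ u in Ioi w, exp (-u ^ 2 / 2) ≤ 3 * exp (-w ^ 2 / 2) := by
  by_cases h1 : 1 ≤ w
  · have := mul_gaussian_tail_le w
    have h0 := gaussian_tail_nonneg w
    nlinarith [exp_pos (-w ^ 2 / 2)]
  · push Not at h1
    have h2 : ∫ u in Ioi w, exp (-u ^ 2 / 2) ≤ ∫ u in Ioi (0 : ℝ), exp (-u ^ 2 / 2) :=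
      setIntegral_mono_set integrable_exp_neg_sq_half.integrableOn
        (Filter.Eventually.of_forall fun u => (exp_pos _).le) (Ioi_subset_Ioi hw).eventuallyLE
    have h3 : ∫ u in Ioi (0 : ℝ), exp (-u ^ 2 / 2) = √(2 * π) / 2 := by
      have h := integral_gaussian_Ioi (1 / 2)
      rw [show π / (1 / 2) = 2 * π by ring] at h
      rw [← h]
      congr 1; funext u; congr 1; ring
    have h4 : 1 / 2 ≤ exp (-w ^ 2 / 2) := by
      have := add_one_le_exp (-w ^ 2 / 2)
      nlinarith
    have := sqrt_two_pi_le
    rw [h3] at h2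
    linarith

lemma gaussian_left_tail (w : ℝ) :
    ∫ u in Iic w, exp (-u ^ 2 / 2) = ∫ u in Ioi (-w), exp (-u ^ 2 / 2) := by
  rw [← integral_comp_neg_Iic w (fun u : ℝ => exp (-u ^ 2 / 2))]
  refine integral_congr_ae (Filter.Eventually.of_forall fun u => ?_)
  simp only
  ring_nf

/-- The solution of the Stein equation `f' w - w f w = h w - E h(Z)` for standard normal `Z`. -/
def steinSol (h : ℝ → ℝ) (w : ℝ) : ℝ :=
  exp (w ^ 2 / 2) * ∫ u in Iic w, (h u - ∫ v, h v ∂(gaussianReal 0 1)) * exp (-u ^ 2 / 2)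

variable {h : ℝ → ℝ}

lemma integrable_gaussianReal_of_mem (hc : Continuous h) (h0 : ∀ u, 0 ≤ h u) (h1 : ∀ u, h u ≤ 1) :
    Integrable h (gaussianReal 0 1) :=
  Integrable.of_bound hc.aestronglyMeasurable 1
    (Filter.Eventually.of_forall fun u => by rw [norm_of_nonneg (h0 u)]; exact h1 u)

lemma abs_sub_integral_le (hc : Continuous h) (h0 : ∀ u, 0 ≤ h u) (h1 : ∀ u, h u ≤ 1) (u : ℝ) :
    |h u - ∫ v, h v ∂(gaussianReal 0 1)| ≤ 1 := by
  have hi := integrable_gaussianReal_of_mem hc h0 h1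
  have a : 0 ≤ ∫ v, h v ∂(gaussianReal 0 1) := integral_nonneg h0
  have b : ∫ v, h v ∂(gaussianReal 0 1) ≤ 1 := by
    have := integral_mono hi (integrable_const (1 : ℝ)) h1
    simpa using this
  rw [abs_le]
  constructor <;> linarith [h0 u, h1 u]

lemma integrable_stein_integrand (hc : Continuous h) (h0 : ∀ u, 0 ≤ h u) (h1 : ∀ u, h u ≤ 1) :
    Integrable (fun u => (h u - ∫ v, h v ∂(gaussianReal 0 1)) * exp (-u ^ 2 / 2)) := by
  refine integrable_exp_neg_sq_half.mono' (by fun_prop) (Filter.Eventually.of_forall fun u => ?_)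
  rw [norm_mul, norm_of_nonneg (exp_pos _).le, norm_eq_abs]
  exact mul_le_of_le_one_left (exp_pos _).le (abs_sub_integral_le hc h0 h1 u)

lemma integral_stein_integrand (hc : Continuous h) (h0 : ∀ u, 0 ≤ h u) (h1 : ∀ u, h u ≤ 1) :
    ∫ u, (h u - ∫ v, h v ∂(gaussianReal 0 1)) * exp (-u ^ 2 / 2) = 0 := by
  have e : ∫ u, (h u - ∫ v, h v ∂(gaussianReal 0 1)) ∂(gaussianReal 0 1) = 0 := by
    rw [integral_sub (integrable_gaussianReal_of_mem hc h0 h1) (integrable_const _)]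
    simp
  rw [integral_gaussianReal_eq_integral_smul one_ne_zero] at e
  simp only [gaussianPDFReal_std, smul_eq_mul, mul_assoc] at e
  rw [integral_const_mul] at e
  have : (√(2 * π))⁻¹ ≠ 0 := inv_ne_zero (by have := two_le_sqrt_two_pi; positivity)
  exact (mul_eq_zero.1 (by simpa only [mul_comm (exp _)] using e)).resolve_left this

lemma hasDerivAt_steinSol (hc : Continuous h) (h0 : ∀ u, 0 ≤ h u) (h1 : ∀ u, h u ≤ 1) (w : ℝ) :
    HasDerivAt (steinSol h)
      (w * steinSol h w + (h w - ∫ v, h v ∂(gaussianReal 0 1))) w := by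
  set k : ℝ → ℝ := fun u => (h u - ∫ v, h v ∂(gaussianReal 0 1)) * exp (-u ^ 2 / 2) with hk
  have hkc : Continuous k := by fun_prop
  have hki : Integrable k := integrable_stein_integrand hc h0 h1
  have hG : HasDerivAt (fun w => ∫ u in Iic w, k u) (k w) w := by
    have e : (fun w => ∫ u in Iic w, k u) = fun w => (∫ u in Iic 0, k u) + ∫ u in (0 : ℝ)..w, k u := by
      funext w
      rw [← intervalIntegral.integral_Iic_sub_Iic hki.integrableOn hki.integrableOn]
      ring
    rw [e]
    exact (intervalIntegral.integral_hasDerivAt_right (hkc.intervalIntegrable _ _)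
      (hkc.stronglyMeasurableAtFilter _ _) hkc.continuousAt).const_add _
  have hE : HasDerivAt (fun w : ℝ => exp (w ^ 2 / 2)) (exp (w ^ 2 / 2) * w) w := by
    have h1 : HasDerivAt (fun u : ℝ => u ^ 2 / 2) w w := by
      exact ((hasDerivAt_pow 2 w).div_const 2).congr_deriv (by norm_num)
    exact h1.exp
  have hm := hE.mul hG
  have e2 : exp (w ^ 2 / 2) * exp (-w ^ 2 / 2) = 1 := by
    rw [← exp_add]; ring_nf; simp
  refine hm.congr_deriv ?_
  simp only [steinSol, hk]
  linear_combination (h w - ∫ v, h v ∂(gaussianReal 0 1)) * e2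

/-- The centred integrand has total integral zero, so for w ≥ 0 the integral over (-∞, w] may be
replaced by minus the one over (w, ∞): only the tail away from the origin is ever used. -/
lemma abs_steinSol_le_tail (hc : Continuous h) (h0 : ∀ u, 0 ≤ h u) (h1 : ∀ u, h u ≤ 1) (w : ℝ) :
    |steinSol h w| ≤ exp (w ^ 2 / 2) * ∫ u in Ioi |w|, exp (-u ^ 2 / 2) := by
  have hki := integrable_stein_integrand hc h0 h1
  have hb : ∀ s : Set ℝ, |∫ u in s, (h u - ∫ v, h v ∂(gaussianReal 0 1)) * exp (-u ^ 2 / 2)| ≤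
      ∫ u in s, exp (-u ^ 2 / 2) := by
    intro s
    rw [← norm_eq_abs]
    refine norm_integral_le_of_norm_le integrable_exp_neg_sq_half.integrableOn
      (Filter.Eventually.of_forall fun u => ?_)
    rw [norm_mul, norm_of_nonneg (exp_pos _).le, norm_eq_abs]
    exact mul_le_of_le_one_left (exp_pos _).le (abs_sub_integral_le hc h0 h1 u)
  rw [steinSol, abs_mul, abs_of_pos (exp_pos _)]
  refine mul_le_mul_of_nonneg_left ?_ (exp_pos _).le
  rcases le_total 0 w with hw | hw
  · rw [abs_of_nonneg hw]
    have e := intervalIntegral.integral_Iic_add_Ioi (b := w) hki.integrableOn hki.integrableOn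
    rw [integral_stein_integrand hc h0 h1] at e
    rw [eq_neg_of_add_eq_zero_left e, abs_neg]
    exact hb _
  · rw [abs_of_nonpos hw, ← gaussian_left_tail]
    exact hb _

lemma abs_steinSol_le (hc : Continuous h) (h0 : ∀ u, 0 ≤ h u) (h1 : ∀ u, h u ≤ 1) (w : ℝ) :
    |steinSol h w| ≤ 3 := by
  refine (abs_steinSol_le_tail hc h0 h1 w).trans ?_
  have e2 : exp (w ^ 2 / 2) * exp (-|w| ^ 2 / 2) = 1 := by
    rw [← exp_add, sq_abs]; ring_nf; simp
  calc _ ≤ exp (w ^ 2 / 2) * (3 * exp (-|w| ^ 2 / 2)) :=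
        mul_le_mul_of_nonneg_left (gaussian_tail_le (abs_nonneg w)) (exp_pos _).le
    _ = 3 := by linear_combination 3 * e2

lemma abs_mul_steinSol_le (hc : Continuous h) (h0 : ∀ u, 0 ≤ h u) (h1 : ∀ u, h u ≤ 1) (w : ℝ) :
    |w * steinSol h w| ≤ 1 := by
  have e2 : exp (w ^ 2 / 2) * exp (-|w| ^ 2 / 2) = 1 := by
    rw [← exp_add, sq_abs]; ring_nf; simp
  rw [abs_mul]
  calc _ ≤ |w| * (exp (w ^ 2 / 2) * ∫ u in Ioi |w|, exp (-u ^ 2 / 2)) :=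
        mul_le_mul_of_nonneg_left (abs_steinSol_le_tail hc h0 h1 w) (abs_nonneg w)
    _ = exp (w ^ 2 / 2) * (|w| * ∫ u in Ioi |w|, exp (-u ^ 2 / 2)) := by ring
    _ ≤ exp (w ^ 2 / 2) * exp (-|w| ^ 2 / 2) :=
        mul_le_mul_of_nonneg_left (mul_gaussian_tail_le _) (exp_pos _).le
    _ = 1 := e2

lemma abs_deriv_steinSol_le (hc : Continuous h) (h0 : ∀ u, 0 ≤ h u) (h1 : ∀ u, h u ≤ 1) (w : ℝ) :
    |w * steinSol h w + (h w - ∫ v, h v ∂(gaussianReal 0 1))| ≤ 2 := by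
  refine (abs_add_le _ _).trans ?_
  linarith [abs_mul_steinSol_le hc h0 h1 w, abs_sub_integral_le hc h0 h1 w]

lemma abs_steinSol_sub_le (hc : Continuous h) (h0 : ∀ u, 0 ≤ h u) (h1 : ∀ u, h u ≤ 1) (s w : ℝ) :
    |steinSol h s - steinSol h w| ≤ 2 * |s - w| := by
  have := Convex.norm_image_sub_le_of_norm_hasDerivWithin_le (s := univ) (x := w) (y := s)
    (fun x _ => (hasDerivAt_steinSol hc h0 h1 x).hasDerivWithinAt)
    (fun x _ => by rw [norm_eq_abs]; exact abs_deriv_steinSol_le hc h0 h1 x)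
    convex_univ (mem_univ _) (mem_univ _)
  simpa using this

/-- The oscillation of the derivative of the Stein solution. -/
lemma abs_deriv_steinSol_sub_le (hc : Continuous h) (h0 : ∀ u, 0 ≤ h u) (h1 : ∀ u, h u ≤ 1)
    (s w : ℝ) :
    |(s * steinSol h s + (h s - ∫ v, h v ∂(gaussianReal 0 1))) -
      (w * steinSol h w + (h w - ∫ v, h v ∂(gaussianReal 0 1)))| ≤
      |s - w| * (3 + 2 * |w|) + |h s - h w| := by
  have e : (s * steinSol h s + (h s - ∫ v, h v ∂(gaussianReal 0 1))) -
      (w * steinSol h w + (h w - ∫ v, h v ∂(gaussianReal 0 1))) =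
      ((s - w) * steinSol h s + w * (steinSol h s - steinSol h w)) + (h s - h w) := by ring
  rw [e]
  refine (abs_add_le _ _).trans (add_le_add_left ((abs_add_le _ _).trans ?_) _)
  rw [abs_mul, abs_mul]
  have a := mul_le_mul_of_nonneg_left (abs_steinSol_le hc h0 h1 s) (abs_nonneg (s - w))
  have b := mul_le_mul_of_nonneg_left (abs_steinSol_sub_le hc h0 h1 s w) (abs_nonneg w)
  linarith

/-- Increments of the standard normal distribution function as integrals of the density. -/
lemma cdf_sub_cdf (a b : ℝ) :
    cdf (gaussianReal 0 1) b - cdf (gaussianReal 0 1) a =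
      ∫ u in a..b, (√(2 * π))⁻¹ * exp (-u ^ 2 / 2) := by
  have hF : ∀ x, cdf (gaussianReal 0 1) x =
      ∫ u in Iic x, (√(2 * π))⁻¹ * exp (-u ^ 2 / 2) := by
    intro x
    rw [cdf_eq_real, measureReal_def, gaussianReal_apply_eq_integral _ one_ne_zero,
      ENNReal.toReal_ofReal (integral_nonneg fun u => gaussianPDFReal_nonneg _ _ _)]
    simp only [gaussianPDFReal_std]
  have hi : Integrable (fun u : ℝ => (√(2 * π))⁻¹ * exp (-u ^ 2 / 2)) :=
    integrable_exp_neg_sq_half.const_mul _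
  rw [hF, hF, intervalIntegral.integral_Iic_sub_Iic hi.integrableOn hi.integrableOn]

lemma cdf_sub_cdf_le {a b : ℝ} (hab : a ≤ b) :
    cdf (gaussianReal 0 1) b - cdf (gaussianReal 0 1) a ≤ (b - a) / 2 := by
  rw [cdf_sub_cdf]
  have : ∫ u in a..b, (√(2 * π))⁻¹ * exp (-u ^ 2 / 2) ≤ ∫ u in a..b, (1 / 2 : ℝ) := by
    refine intervalIntegral.integral_mono_on hab
      (Continuous.intervalIntegrable (by fun_prop) _ _) (by simp) fun u _ => ?_
    have h1 : (√(2 * π))⁻¹ ≤ 1 / 2 := by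
      rw [inv_le_comm₀ (by have := two_le_sqrt_two_pi; positivity) (by norm_num)]
      simpa using two_le_sqrt_two_pi
    have h2 : exp (-u ^ 2 / 2) ≤ 1 := by
      rw [exp_le_one_iff]; nlinarith [sq_nonneg u]
    have h3 : (0 : ℝ) ≤ (√(2 * π))⁻¹ := by positivity
    nlinarith [exp_pos (-u ^ 2 / 2)]
  refine this.trans (le_of_eq ?_)
  rw [intervalIntegral.integral_const, smul_eq_mul]
  ring

end Stein

/-! ### From bounded increments to a Kolmogorov bound -/

section SteinBound

/-- The piecewise linear function equal to `1` on `(-∞, z]` and to `0` on `[z + a, ∞)`. -/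
def ramp (z a w : ℝ) : ℝ := max 0 (min 1 (1 + (z - w) / a))

lemma continuous_ramp (z a : ℝ) : Continuous (ramp z a) := by
  unfold ramp; fun_prop

lemma ramp_nonneg (z a w : ℝ) : 0 ≤ ramp z a w := le_max_left _ _

lemma ramp_le_one (z a w : ℝ) : ramp z a w ≤ 1 := max_le zero_le_one (min_le_left _ _)

lemma ramp_eq_one {z a w : ℝ} (ha : 0 < a) (hw : w ≤ z) : ramp z a w = 1 := by
  have : 0 ≤ (z - w) / a := div_nonneg (by linarith) ha.le
  rw [ramp, min_eq_left (by linarith), max_eq_right zero_le_one]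

lemma ramp_eq_zero {z a w : ℝ} (ha : 0 < a) (hw : z + a ≤ w) : ramp z a w = 0 := by
  have : (z - w) / a ≤ -1 := by rw [div_le_iff₀ ha]; linarith
  rw [ramp, max_eq_left]
  exact (min_le_right _ _).trans (by linarith)

lemma abs_ramp_sub_le {z a : ℝ} (ha : 0 < a) (s w : ℝ) :
    |ramp z a s - ramp z a w| ≤ |s - w| / a := by
  unfold ramp
  refine (abs_max_sub_max_le_max _ _ _ _).trans ?_
  rw [sub_self, abs_zero]
  refine max_le (by positivity) ((abs_min_sub_min_le_max _ _ _ _).trans ?_)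
  rw [sub_self, abs_zero]
  refine max_le (by positivity) (le_of_eq ?_)
  rw [show 1 + (z - s) / a - (1 + (z - w) / a) = (w - s) / a by ring, abs_div, abs_of_pos ha,
    abs_sub_comm]

/-- The ramp is constant outside [z, z + a], so only points w near this interval see a change, and
there the slope is at most 1/a. -/
lemma abs_ramp_sub_le_indicator {z a e s w : ℝ} (ha : 0 < a) (he : 0 < e) (hs : |s - w| ≤ e) :
    |ramp z a s - ramp z a w| ≤
      e / a * ((if w ≤ z + a + e then 1 else 0) - (if w ≤ z - 2 * e then 1 else 0)) := by
  have hs' := abs_le.1 hs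
  by_cases h1 : w ≤ z - 2 * e
  · rw [ramp_eq_one ha (by linarith), ramp_eq_one ha (by linarith), if_pos (by linarith),
      if_pos h1]
    simp
  by_cases h2 : w ≤ z + a + e
  · rw [if_pos h2, if_neg h1, sub_zero, mul_one]
    exact (abs_ramp_sub_le ha s w).trans (by gcongr)
  · rw [ramp_eq_zero ha (by linarith), ramp_eq_zero ha (by linarith), if_neg h1, if_neg h2]
    simp

variable {ι α κ : Type*} [Fintype ι] [DecidableEq ι] [Fintype α] [DecidableEq α] [Fintype κ]
  {p : α → ℝ}

/-- Error bound in the Stein equation for a smoothed indicator, for a variable `Y` whose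
covariances are represented by weighted bounded increments. -/
lemma abs_expect_ramp_sub_le (h0 : ∀ v, 0 ≤ p v) (h1 : ∑ v, p v = 1)
    (Y : (ι → α) → ℝ) (μ σ Λ V : ℝ) (hσ : 0 < σ)
    (hvar : expect p (fun x => (Y x - μ) ^ 2) = σ ^ 2)
    (g Y₁ Y₂ : κ → (ι → α) → ℝ)
    (hid : ∀ f : ℝ → ℝ, expect p (fun x => (Y x - μ) * f (Y x)) =
      expect p (fun x => ∑ k, g k x * (f (Y₂ k x) - f (Y₁ k x))))
    (hg : ∀ k x, 0 ≤ g k x) (hsum : ∀ x, ∑ k, g k x ≤ 2 * Λ)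
    (hY1 : ∀ k x, |Y₁ k x - Y x| ≤ 4) (hY2 : ∀ k x, |Y₂ k x - Y x| ≤ 4)
    (hY12 : ∀ k x, |Y₂ k x - Y₁ k x| ≤ 2)
    (hV : expect p (fun x => (∑ k, g k x * (Y₂ k x - Y₁ k x) - σ ^ 2) ^ 2) ≤ V)
    (z a : ℝ) (ha : 0 < a) :
    |expect p (fun x => ramp z a ((Y x - μ) / σ)) - ∫ v, ramp z a v ∂(gaussianReal 0 1)| ≤
      2 * √V / σ ^ 2 + 4 * Λ / σ ^ 2 * (5 * (4 / σ) + 4 / σ / a *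
        (expect p (fun x => if (Y x - μ) / σ ≤ z + a + 4 / σ then 1 else 0) -
          expect p (fun x => if (Y x - μ) / σ ≤ z - 2 * (4 / σ) then 1 else 0))) := by
  set h := ramp z a with hh
  have hc : Continuous h := continuous_ramp z a
  have hn : ∀ u, 0 ≤ h u := ramp_nonneg z a
  have hl : ∀ u, h u ≤ 1 := ramp_le_one z a
  set W : (ι → α) → ℝ := fun x => (Y x - μ) / σ with hW
  set f := steinSol h with hf
  set f' : ℝ → ℝ := fun w => w * f w + (h w - ∫ v, h v ∂(gaussianReal 0 1)) with hf'
  set T : (ι → α) → ℝ := fun x => ∑ k, g k x * (Y₂ k x - Y₁ k x) with hT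
  set η := 4 / σ with hη
  have hηpos : 0 < η := by positivity
  set B : (ι → α) → ℝ := fun x => η * (3 + 2 * |W x|) +
    η / a * ((if W x ≤ z + a + η then 1 else 0) - (if W x ≤ z - 2 * η then 1 else 0)) with hB
  have hosc : ∀ x s, |s - W x| ≤ η → |f' s - f' (W x)| ≤ B x := by
    intro x s hs
    refine (abs_deriv_steinSol_sub_le hc hn hl s (W x)).trans (add_le_add ?_ ?_)
    · exact mul_le_mul_of_nonneg_right hs (by positivity)
    · exact abs_ramp_sub_le_indicator ha hηpos hs
  have hB0 : ∀ x, 0 ≤ B x := fun x => (abs_nonneg _).trans (hosc x (W x) (by simpa using hηpos.le))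
  -- Mean value inequality for s ↦ f s - f'(W) s: both end points lie within η of W, where the
  -- derivative is at most B, and they are at most 2/σ apart.
  have hinc : ∀ k x, |f ((Y₂ k x - μ) / σ) - f ((Y₁ k x - μ) / σ) -
      f' (W x) * ((Y₂ k x - Y₁ k x) / σ)| ≤ B x * (2 / σ) := by
    intro k x
    have hder : ∀ s ∈ Set.Icc (W x - η) (W x + η), HasDerivWithinAt
        (fun s => f s - f' (W x) * s) (f' s - f' (W x)) (Set.Icc (W x - η) (W x + η)) s := by
      intro s _
      have := (hasDerivAt_steinSol hc hn hl s).sub ((hasDerivAt_id s).const_mul (f' (W x)))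
      exact (this.congr_deriv (by simp [hf', hf])).hasDerivWithinAt
    have hmem : ∀ y : ℝ, |y - Y x| ≤ 4 → (y - μ) / σ ∈ Set.Icc (W x - η) (W x + η) := by
      intro y hy
      have e : (y - μ) / σ = W x + (y - Y x) / σ := by simp only [hW]; ring
      have b := abs_le.1 hy
      have b1 : (y - Y x) / σ ≤ η := div_le_div_of_nonneg_right b.2 hσ.le
      have b2 : -η ≤ (y - Y x) / σ := by
        rw [hη, ← neg_div]; exact div_le_div_of_nonneg_right b.1 hσ.le
      rw [e]
      constructor <;> linarith
    have := Convex.norm_image_sub_le_of_norm_hasDerivWithin_le (C := B x) hder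
      (fun s hs => by
        rw [Real.norm_eq_abs]
        exact hosc x s (by rw [abs_le]; constructor <;> linarith [hs.1, hs.2]))
      (convex_Icc _ _) (hmem _ (hY1 k x)) (hmem _ (hY2 k x))
    rw [Real.norm_eq_abs, Real.norm_eq_abs] at this
    have e1 : (Y₂ k x - μ) / σ - (Y₁ k x - μ) / σ = (Y₂ k x - Y₁ k x) / σ := by ring
    have e2 : f ((Y₂ k x - μ) / σ) - f' (W x) * ((Y₂ k x - μ) / σ) -
        (f ((Y₁ k x - μ) / σ) - f' (W x) * ((Y₁ k x - μ) / σ)) =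
        f ((Y₂ k x - μ) / σ) - f ((Y₁ k x - μ) / σ) - f' (W x) * ((Y₂ k x - Y₁ k x) / σ) := by
      ring
    rw [e1, e2] at this
    refine this.trans (mul_le_mul_of_nonneg_left ?_ (hB0 x))
    rw [abs_div, abs_of_pos hσ]
    exact div_le_div_of_nonneg_right (hY12 k x) hσ.le
  have hWf : expect p (fun x => W x * f (W x)) =
      expect p (fun x => ∑ k, g k x * (f ((Y₂ k x - μ) / σ) - f ((Y₁ k x - μ) / σ)) / σ) := by
    have e := hid (fun y => f ((y - μ) / σ))
    have e1 : (fun x => W x * f (W x)) = fun x => (Y x - μ) * f ((Y x - μ) / σ) * (1 / σ) := by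
      funext x; simp only [hW]; ring
    rw [e1, expect_mul_right, e, ← expect_mul_right]
    congr 1; funext x
    rw [Finset.sum_mul]
    exact Finset.sum_congr rfl fun k _ => by ring
  -- By the Stein equation the left side is E[f'(W) - W f(W)]. Linearising the covariance identity
  -- at W splits it into the deviation of T from σ² and the first-order remainders.
  have hmain : expect p (fun x => h (W x)) - ∫ v, h v ∂(gaussianReal 0 1) =
      expect p (fun x => f' (W x) * (σ ^ 2 - T x) * (1 / σ ^ 2) -
        ∑ k, g k x * (f ((Y₂ k x - μ) / σ) - f ((Y₁ k x - μ) / σ) -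
          f' (W x) * ((Y₂ k x - Y₁ k x) / σ)) / σ) := by
    have e1 : expect p (fun x => h (W x)) - ∫ v, h v ∂(gaussianReal 0 1) =
        expect p (fun x => f' (W x) - W x * f (W x)) := by
      conv_lhs => rw [← expect_const (ι := ι) h1 (∫ v, h v ∂(gaussianReal 0 1)), ← expect_sub]
      congr 1; funext x
      simp only [hf']; ring
    rw [e1, expect_sub, hWf, ← expect_sub]
    congr 1; funext x
    have e2 : ∑ k, g k x * (f ((Y₂ k x - μ) / σ) - f ((Y₁ k x - μ) / σ) -
          f' (W x) * ((Y₂ k x - Y₁ k x) / σ)) / σ =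
        ∑ k, g k x * (f ((Y₂ k x - μ) / σ) - f ((Y₁ k x - μ) / σ)) / σ -
          f' (W x) * T x * (1 / σ ^ 2) := by
      simp only [hT]
      rw [Finset.mul_sum, Finset.sum_mul, ← Finset.sum_sub_distrib]
      refine Finset.sum_congr rfl fun k _ => ?_
      field_simp
    rw [e2]
    field_simp
    ring
  rw [hmain, expect_sub]
  refine (abs_sub _ _).trans (add_le_add ?_ ?_)
  · refine (abs_expect_le h0 _).trans ?_
    have b1 : expect p (fun x => |f' (W x) * (σ ^ 2 - T x) * (1 / σ ^ 2)|) ≤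
        expect p (fun x => 2 / σ ^ 2 * |T x - σ ^ 2|) := by
      refine expect_mono h0 fun x => ?_
      rw [abs_mul, abs_mul, abs_of_pos (show 0 < 1 / σ ^ 2 by positivity), abs_sub_comm]
      have := mul_le_mul_of_nonneg_right (abs_deriv_steinSol_le hc hn hl (W x))
        (abs_nonneg (T x - σ ^ 2))
      calc _ ≤ 2 * |T x - σ ^ 2| * (1 / σ ^ 2) :=
            mul_le_mul_of_nonneg_right this (by positivity)
        _ = _ := by ring
    refine b1.trans ?_
    rw [expect_mul_left]
    have b2 : expect p (fun x => |T x - σ ^ 2|) ≤ √V := by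
      apply Real.le_sqrt_of_sq_le
      refine (sq_expect_le h0 h1 _).trans ?_
      simpa only [sq_abs] using hV
    calc _ ≤ 2 / σ ^ 2 * √V := mul_le_mul_of_nonneg_left b2 (by positivity)
      _ = _ := by ring
  · refine (abs_expect_le h0 _).trans ?_
    have b1 : expect p (fun x => |∑ k, g k x * (f ((Y₂ k x - μ) / σ) - f ((Y₁ k x - μ) / σ) -
          f' (W x) * ((Y₂ k x - Y₁ k x) / σ)) / σ|) ≤
        expect p (fun x => 4 * Λ / σ ^ 2 * B x) := by
      refine expect_mono h0 fun x => (Finset.abs_sum_le_sum_abs _ _).trans ?_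
      calc _ ≤ ∑ k, g k x * (B x * (2 / σ) / σ) := by
            refine Finset.sum_le_sum fun k _ => ?_
            rw [mul_div_assoc, abs_mul, abs_of_nonneg (hg k x), abs_div, abs_of_pos hσ]
            exact mul_le_mul_of_nonneg_left
              (div_le_div_of_nonneg_right (hinc k x) hσ.le) (hg k x)
        _ = (∑ k, g k x) * (B x * (2 / σ) / σ) := by rw [Finset.sum_mul]
        _ ≤ 2 * Λ * (B x * (2 / σ) / σ) :=
            mul_le_mul_of_nonneg_right (hsum x)
              (by have := hB0 x; positivity)
        _ = _ := by field_simp; ring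
    refine b1.trans ?_
    rw [expect_mul_left]
    have hΛ : 0 ≤ Λ := by
      have hx := expect_mono (p := p) h0 hsum
      rw [expect_const h1] at hx
      have := expect_nonneg (p := p) h0 (fun x => Finset.sum_nonneg fun k (_ : k ∈ Finset.univ) => hg k x)
      linarith
    refine mul_le_mul_of_nonneg_left ?_ (by positivity)
    simp only [hB]
    rw [expect_add, expect_mul_left, expect_mul_left, expect_sub, expect_add, expect_const h1,
      expect_mul_left]
    -- Since E W² = 1, the factor 3 + 2|W| has mean at most 5.
    have hEW : expect p (fun x => |W x|) ≤ 1 := by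
      have : expect p (fun x => |W x|) ^ 2 ≤ 1 := by
        refine (sq_expect_le h0 h1 _).trans (le_of_eq ?_)
        have e : (fun x => |W x| ^ 2) = fun x => (1 / σ ^ 2) * (Y x - μ) ^ 2 := by
          funext x; rw [sq_abs]; simp only [hW]; ring
        rw [e, expect_mul_left, hvar]
        field_simp
      exact le_of_abs_le ((sq_le_one_iff_abs_le_one _).1 this)
    have := mul_le_mul_of_nonneg_left hEW hηpos.le
    nlinarith

/-- A Berry–Esseen bound by Stein's method with bounded increments. -/
theorem kolmogorov_le_of_increments (h0 : ∀ v, 0 ≤ p v) (h1 : ∑ v, p v = 1)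
    (Y : (ι → α) → ℝ) (μ σ L V D : ℝ) (hσ : 0 < σ) (hL : 0 < L)
    (hvar : expect p (fun x => (Y x - μ) ^ 2) = σ ^ 2)
    (g Y₁ Y₂ : κ → (ι → α) → ℝ)
    (hid : ∀ f : ℝ → ℝ, expect p (fun x => (Y x - μ) * f (Y x)) =
      expect p (fun x => ∑ k, g k x * (f (Y₂ k x) - f (Y₁ k x))))
    (hg : ∀ k x, 0 ≤ g k x) (hsum : ∀ x, ∑ k, g k x ≤ 2 * (L * σ ^ 2))
    (hY1 : ∀ k x, |Y₁ k x - Y x| ≤ 4) (hY2 : ∀ k x, |Y₂ k x - Y x| ≤ 4)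
    (hY12 : ∀ k x, |Y₂ k x - Y₁ k x| ≤ 2)
    (hV : expect p (fun x => (∑ k, g k x * (Y₂ k x - Y₁ k x) - σ ^ 2) ^ 2) ≤ V)
    (hD : ∀ t, |expect p (fun x => if (Y x - μ) / σ ≤ t then 1 else 0) -
      cdf (gaussianReal 0 1) t| ≤ D) (t : ℝ) :
    |expect p (fun x => if (Y x - μ) / σ ≤ t then 1 else 0) - cdf (gaussianReal 0 1) t| ≤
      D / 2 + (2 * √V / σ ^ 2 + (120 * L + 3 / 2) / σ) := by
  set F : ℝ → ℝ := fun t => expect p (fun x => if (Y x - μ) / σ ≤ t then 1 else 0) with hF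
  set η := 4 / σ with hη
  have hηpos : 0 < η := by positivity
  -- With this width the window probability is multiplied by 4L · η/a = 1/4, so its part 2D
  -- contributes exactly D/2.
  set a := 16 * L * η with ha
  have hapos : 0 < a := by positivity
  set K := D / 2 + (2 * √V / σ ^ 2 + (120 * L + 3 / 2) / σ) with hK
  have hsm : ∀ z, |expect p (fun x => ramp z a ((Y x - μ) / σ)) -
      ∫ v, ramp z a v ∂(gaussianReal 0 1)| ≤ K - a / 2 := by
    intro z
    refine (abs_expect_ramp_sub_le h0 h1 Y μ σ (L * σ ^ 2) V hσ hvar g Y₁ Y₂ hid hg hsum hY1 hY2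
      hY12 hV z a hapos).trans ?_
    -- The unknown window probability is itself compared with the Gaussian one, at cost D for each
    -- end point.
    have hP : F (z + a + η) - F (z - 2 * η) ≤ 2 * D + (a + 3 * η) / 2 := by
      have b1 := (abs_le.1 (hD (z + a + η))).2
      have b2 := (abs_le.1 (hD (z - 2 * η))).1
      have b3 := cdf_sub_cdf_le (show z - 2 * η ≤ z + a + η by linarith)
      simp only [hF]
      linarith
    have e1 : 4 * (L * σ ^ 2) / σ ^ 2 = 4 * L := by field_simp
    have e2 : η / a = 1 / (16 * L) := by rw [ha]; field_simp
    rw [e1, e2]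
    calc _ ≤ 2 * √V / σ ^ 2 + 4 * L * (5 * η + 1 / (16 * L) * (2 * D + (a + 3 * η) / 2)) := by
          gcongr
      _ = K - a / 2 := by
          rw [hK, ha, hη]; field_simp; ring
  have hRle : ∀ z, ∫ v, ramp z a v ∂(gaussianReal 0 1) ≤ cdf (gaussianReal 0 1) z + a / 2 := by
    intro z
    have hi : ∫ v, ramp z a v ∂(gaussianReal 0 1) ≤ cdf (gaussianReal 0 1) (z + a) := by
      rw [cdf_eq_real, ← integral_indicator_one measurableSet_Iic]
      refine integral_mono (integrable_gaussianReal_of_mem (continuous_ramp z a) (ramp_nonneg z a)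
        (ramp_le_one z a)) ((integrable_const 1).indicator measurableSet_Iic) fun v => ?_
      by_cases hv : v ≤ z + a
      · simpa [Set.indicator_of_mem (show v ∈ Set.Iic (z + a) from hv)] using ramp_le_one z a v
      · simp only
        rw [ramp_eq_zero hapos (by linarith), Set.indicator_of_notMem (by simpa using hv)]
    have := cdf_sub_cdf_le (show z ≤ z + a by linarith)
    linarith
  have hRge : ∀ z, cdf (gaussianReal 0 1) z ≤ ∫ v, ramp z a v ∂(gaussianReal 0 1) := by
    intro z
    rw [cdf_eq_real, ← integral_indicator_one measurableSet_Iic]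
    refine integral_mono ((integrable_const 1).indicator measurableSet_Iic)
      (integrable_gaussianReal_of_mem (continuous_ramp z a) (ramp_nonneg z a)
        (ramp_le_one z a)) fun v => ?_
    by_cases hv : v ≤ z
    · simp only
      rw [ramp_eq_one hapos hv, Set.indicator_of_mem (show v ∈ Set.Iic z from hv)]
      simp
    · rw [Set.indicator_of_notMem (by simpa using hv)]
      exact ramp_nonneg z a v
  -- The sharp indicator at t lies between the ramps starting at t - a and at t. Comparing the
  -- Gaussian integrals of these ramps with Φ(t) costs a/2 on either side, since the density is at
  -- most 1/2.
  have hEge : F t ≤ expect p (fun x => ramp t a ((Y x - μ) / σ)) := by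
    refine expect_mono h0 fun x => ?_
    split_ifs with hx
    · rw [ramp_eq_one hapos hx]
    · exact ramp_nonneg _ _ _
  have hEle : expect p (fun x => ramp (t - a) a ((Y x - μ) / σ)) ≤ F t := by
    refine expect_mono h0 fun x => ?_
    split_ifs with hx
    · exact ramp_le_one _ _ _
    · rw [ramp_eq_zero hapos (by linarith)]
  have s1 := (abs_le.1 (hsm t)).2
  have s2 := (abs_le.1 (hsm (t - a))).1
  have r1 := hRle t
  have r2 := hRge (t - a)
  have r3 := cdf_sub_cdf_le (show t - a ≤ t by linarith)
  rw [abs_le]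
  constructor <;> linarith

end SteinBound

/-! ### Occupancy counts and the effect of moving one ball -/

section Counts

variable {n m : ℕ}

/-- The number of non-isolated balls of an allocation. -/
def nonIso (x : Fin n → Fin m) : ℝ := ∑ i : Fin n, if 0 < companions x i then 1 else 0

/-- The number of balls other than `i` in the urn `v`. -/
def others (x : Fin n → Fin m) (i : Fin n) (v : Fin m) : ℕ :=
  (Finset.univ.filter fun j => j ≠ i ∧ x j = v).card

/-- The contribution of an urn with `k` balls to the number of non-isolated balls. -/
def urnValue (k : ℕ) : ℝ := if 2 ≤ k then k else 0

/-- The increment of `urnValue`. -/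
def urnStep (k : ℕ) : ℝ := urnValue (k + 1) - urnValue k

/-- The steps are 0, 2, 1, 1, …: the second ball in an urn ends the isolation of two balls at once.
-/
lemma urnStep_nonneg (k : ℕ) : 0 ≤ urnStep k := by
  unfold urnStep urnValue
  rcases k with _ | _ | k <;> norm_num

lemma urnStep_le (k : ℕ) : urnStep k ≤ 2 := by
  unfold urnStep urnValue
  rcases k with _ | _ | k <;> norm_num

lemma card_eq_others_add (x : Fin n → Fin m) (i : Fin n) (v : Fin m) :
    (Finset.univ.filter fun j => x j = v).card = others x i v + if x i = v then 1 else 0 := by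
  unfold others
  rw [← Finset.card_filter_add_card_filter_not (s := Finset.univ.filter fun j => x j = v)
    (fun j => j ≠ i), Finset.filter_filter, Finset.filter_filter]
  congr 1
  · congr 1; ext j; simp [and_comm]
  · split_ifs with h
    · rw [Finset.card_eq_one]
      refine ⟨i, ?_⟩
      ext j
      simp only [Finset.mem_filter, Finset.mem_univ, true_and, Finset.mem_singleton, not_not]
      exact ⟨fun h => h.2, fun hj => ⟨hj ▸ h, hj⟩⟩
    · rw [Finset.card_eq_zero]
      ext j
      simp only [Finset.mem_filter, Finset.mem_univ, true_and, not_not, Finset.notMem_empty,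
        iff_false, not_and]
      rintro h1 rfl
      exact h h1

lemma companions_eq (x : Fin n → Fin m) (i : Fin n) : companions x i = others x i (x i) := by
  have h := card_eq_others_add x i (x i)
  have e : ∑ j : Fin n, (if x j = x i then (1 : ℤ) else 0) =
      ((Finset.univ.filter fun j => x j = x i).card : ℤ) := by
    simp
  rw [companions, e, h]
  simp

lemma nonIso_eq_sum_urns (x : Fin n → Fin m) :
    nonIso x = ∑ v, urnValue (Finset.univ.filter fun j => x j = v).card := by
  unfold nonIso
  rw [← Finset.sum_fiberwise Finset.univ x]
  refine Finset.sum_congr rfl fun v _ => ?_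
  have : ∀ i ∈ Finset.univ.filter (fun j => x j = v), (if 0 < companions x i then (1 : ℝ) else 0) =
      if 2 ≤ (Finset.univ.filter fun j => x j = v).card then 1 else 0 := by
    intro i hi
    have hi' : x i = v := by simpa using hi
    rw [companions_eq, hi', card_eq_others_add x i v, if_pos hi']
    congr 1
    simp only [eq_iff_iff]
    omega
  rw [Finset.sum_congr rfl this, Finset.sum_const, nsmul_eq_mul, urnValue]
  split_ifs <;> simp

lemma others_update_self (x : Fin n → Fin m) (i : Fin n) (c v : Fin m) :
    others (update x i c) i v = others x i v := by
  unfold others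
  congr 1
  ext j
  simp only [Finset.mem_filter, Finset.mem_univ, true_and]
  refine and_congr_right fun h => ?_
  rw [update_of_ne h]

lemma others_update (x : Fin n → Fin m) (k i : Fin n) (c v : Fin m) (h1 : v ≠ x k) (h2 : v ≠ c) :
    others (update x k c) i v = others x i v := by
  unfold others
  congr 1
  ext j
  simp only [Finset.mem_filter, Finset.mem_univ, true_and]
  refine and_congr_right fun _ => ?_
  by_cases hj : j = k
  · subst hj
    simp [h1.symm, h2.symm]
  · rw [update_of_ne hj]

lemma nonIso_eq_others (x : Fin n → Fin m) (i : Fin n) :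
    nonIso x = (∑ v, urnValue (others x i v)) + urnStep (others x i (x i)) := by
  rw [nonIso_eq_sum_urns]
  have : ∀ v, urnValue (Finset.univ.filter fun j => x j = v).card =
      urnValue (others x i v) + if x i = v then urnStep (others x i v) else 0 := by
    intro v
    rw [card_eq_others_add x i v]
    split_ifs <;> simp [urnStep]
  simp only [this, Finset.sum_add_distrib, Finset.sum_ite_eq, Finset.mem_univ, if_true]

lemma nonIso_update_sub (x : Fin n → Fin m) (i : Fin n) (b : Fin m) :
    nonIso (update x i b) - nonIso x = urnStep (others x i b) - urnStep (others x i (x i)) := by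
  rw [nonIso_eq_others (update x i b) i, nonIso_eq_others x i]
  simp only [others_update_self, update_self]
  ring

lemma abs_nonIso_update_sub_le (x : Fin n → Fin m) (i : Fin n) (b : Fin m) :
    |nonIso (update x i b) - nonIso x| ≤ 2 := by
  rw [nonIso_update_sub, abs_le]
  constructor <;> linarith [urnStep_nonneg (others x i b), urnStep_nonneg (others x i (x i)),
    urnStep_le (others x i b), urnStep_le (others x i (x i))]

/-- The increment of moving j to b depends only on the contents of the urns y_j and b, and moving k
from y_k to c touches neither. -/
lemma nonIso_increment_update (y : Fin n → Fin m) (k j : Fin n) (b c : Fin m) (hb : b ≠ y k)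
    (hbc : b ≠ c) (hjk : j ≠ k) (hj : y j ≠ y k) (hjc : y j ≠ c) :
    nonIso (update (update y k c) j b) - nonIso (update y k c) =
      nonIso (update y j b) - nonIso y := by
  rw [nonIso_update_sub, nonIso_update_sub, update_of_ne hjk, others_update _ _ _ _ _ hb hbc,
    others_update _ _ _ _ _ hj hjc]

end Counts

/-! ### The covariance identity -/

section Coupling

variable {n m : ℕ} {p : Fin m → ℝ}

/-- The indicator that ball `j` lies in urn `b`. -/
def ind (x : Fin n → Fin m) (j : Fin n) (b : Fin m) : ℝ := if x j = b then 1 else 0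

/-- The weight attached to the move of ball `j` to the urn `b` after ball `i`. -/
def moveWeight (p : Fin m → ℝ) (x : Fin n → Fin m) (i j : Fin n) (b : Fin m) : ℝ :=
  (∏ l ∈ Finset.univ.erase i with l < j, (1 - ind x l b)) *
    ∏ l ∈ Finset.univ.erase i with j < l, (1 - p b)

/-- The probability that at least one of `n - 1` balls lies in urn `b`. -/
def hitProb (n : ℕ) (p : Fin m → ℝ) (b : Fin m) : ℝ := 1 - (1 - p b) ^ (n - 1)

lemma ind_nonneg (x : Fin n → Fin m) (j : Fin n) (b : Fin m) : 0 ≤ ind x j b := by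
  unfold ind; split_ifs <;> norm_num

lemma ind_le_one (x : Fin n → Fin m) (j : Fin n) (b : Fin m) : ind x j b ≤ 1 := by
  unfold ind; split_ifs <;> norm_num

lemma moveWeight_nonneg (hp1 : ∀ b, p b ≤ 1) (x : Fin n → Fin m) (i j : Fin n) (b : Fin m) :
    0 ≤ moveWeight p x i j b :=
  mul_nonneg (Finset.prod_nonneg fun l _ => by linarith [ind_le_one x l b])
    (Finset.prod_nonneg fun l _ => by linarith [hp1 b])

lemma moveWeight_le_one (h0 : ∀ b, 0 ≤ p b) (hp1 : ∀ b, p b ≤ 1) (x : Fin n → Fin m)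
    (i j : Fin n) (b : Fin m) : moveWeight p x i j b ≤ 1 :=
  mul_le_one₀ (Finset.prod_le_one (fun l _ => by linarith [ind_le_one x l b])
      (fun l _ => by linarith [ind_nonneg x l b]))
    (Finset.prod_nonneg fun l _ => by linarith [hp1 b])
    (Finset.prod_le_one (fun l _ => by linarith [hp1 b]) (fun l _ => by linarith [h0 b]))

lemma moveWeight_update_self (x : Fin n → Fin m) (i j : Fin n) (b c : Fin m) :
    moveWeight p (update x j c) i j b = moveWeight p x i j b := by
  unfold moveWeight
  congr 1
  refine Finset.prod_congr rfl fun l hl => ?_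
  rw [ind, ind, update_of_ne (ne_of_lt (Finset.mem_filter.1 hl).2)]

lemma moveWeight_update (x : Fin n → Fin m) (k i j : Fin n) (b c : Fin m) (h1 : b ≠ x k)
    (h2 : b ≠ c) : moveWeight p (update x k c) i j b = moveWeight p x i j b := by
  unfold moveWeight
  congr 1
  refine Finset.prod_congr rfl fun l hl => ?_
  by_cases hlk : l = k
  · subst hlk
    simp [ind, h1.symm, h2.symm]
  · rw [ind, ind, update_of_ne hlk]

lemma hitProb_nonneg (h0 : ∀ b, 0 ≤ p b) (hp1 : ∀ b, p b ≤ 1) (b : Fin m) :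
    0 ≤ hitProb n p b := by
  have := pow_le_one₀ (n := n - 1) (by linarith [hp1 b] : 0 ≤ 1 - p b) (by linarith [h0 b])
  unfold hitProb; linarith

lemma hitProb_le (h0 : ∀ b, 0 ≤ p b) (hp1 : ∀ b, p b ≤ 1) (b : Fin m) :
    hitProb n p b ≤ n * p b := by
  have h := one_add_mul_le_pow (show (-2 : ℝ) ≤ -p b by linarith [hp1 b]) (n - 1)
  have h2 : ((n - 1 : ℕ) : ℝ) ≤ n := by exact_mod_cast Nat.sub_le n 1
  rw [← sub_eq_add_neg] at h
  unfold hitProb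
  nlinarith [h0 b]

/-- Telescoping: in the product of 1 - ind over the balls other than i, the factors are replaced by
1 - p b one ball at a time. Each weight omits ball j, so j can be resampled without changing the
weight. -/
lemma occupied_eq (x : Fin n → Fin m) (i : Fin n) (b : Fin m) :
    (if 0 < others x i b then (1 : ℝ) else 0) =
      hitProb n p b + ∑ j ∈ Finset.univ.erase i, (ind x j b - p b) * moveWeight p x i j b := by
  have h := Finset.prod_sub_ordered (Finset.univ.erase i) (fun _ => 1 - p b)
    (fun j => ind x j b - p b)
  have e1 : ∀ j, (1 - p b - (ind x j b - p b)) = 1 - ind x j b := fun j => by ring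
  simp only [e1] at h
  have e2 : (∏ j ∈ Finset.univ.erase i, (1 - ind x j b)) =
      1 - if 0 < others x i b then (1 : ℝ) else 0 := by
    by_cases ho : 0 < others x i b
    · obtain ⟨j, hj⟩ := Finset.card_pos.1 ho
      simp only [Finset.mem_filter, Finset.mem_univ, true_and] at hj
      rw [if_pos ho, sub_self]
      exact Finset.prod_eq_zero (Finset.mem_erase.2 ⟨hj.1, Finset.mem_univ j⟩) (by simp [ind, hj.2])
    · rw [if_neg ho, sub_zero]
      refine Finset.prod_eq_one fun j hj => ?_
      have hne : x j ≠ b := by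
        intro hxb
        refine ho (Finset.card_pos.2 ⟨j, ?_⟩)
        simpa using ⟨Finset.ne_of_mem_erase hj, hxb⟩
      simp [ind, hne]
  rw [e2, Finset.prod_const, Finset.card_erase_of_mem (Finset.mem_univ i), Finset.card_univ,
    Fintype.card_fin] at h
  have e3 : ∑ j ∈ Finset.univ.erase i, (ind x j b - p b) * moveWeight p x i j b =
      ∑ j ∈ Finset.univ.erase i,
        ((ind x j b - p b) * ∏ l ∈ Finset.univ.erase i with l < j, (1 - ind x l b)) *
          ∏ l ∈ Finset.univ.erase i with j < l, (1 - p b) :=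
    Finset.sum_congr rfl fun j _ => by rw [moveWeight]; ring
  rw [e3, hitProb]
  linarith

/-- Moves of a single ball to an urn, and moves of a second ball to the same urn. -/
abbrev Move (n m : ℕ) : Type := (Fin n × Fin m) ⊕ (Fin n × Fin n × Fin m)

/-- The weight of a move. -/
def weight (p : Fin m → ℝ) : Move n m → (Fin n → Fin m) → ℝ
  | .inl (_, b), _ => p b * hitProb n p b
  | .inr (i, j, b), x => if j = i then 0 else p b * p b * moveWeight p x i j b

/-- The allocation before a move. -/
def before : Move n m → (Fin n → Fin m) → (Fin n → Fin m)
  | .inl _, x => x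
  | .inr (i, _, b), x => update x i b

/-- The allocation after a move. -/
def after : Move n m → (Fin n → Fin m) → (Fin n → Fin m)
  | .inl (i, b), x => update x i b
  | .inr (i, j, b), x => update (update x i b) j b

lemma expect_centered_ind_mul (h1 : ∑ v, p v = 1) (j : Fin n) (b : Fin m)
    (G : (Fin n → Fin m) → ℝ) :
    expect p (fun x => (ind x j b - p b) * G x) =
      p b * expect p (fun x => G (update x j b) - G x) := by
  simp only [sub_mul]
  rw [expect_sub, expect_sub, expect_mul_left, mul_sub]
  congr 1
  exact expect_indicator_mul h1 j b G

/-- Conditioning on ball i lying in b places i there. The mean of the occupation indicator gives the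
`hitProb` term, and its centred parts give the moves of a second ball j to the same urn. -/
lemma expect_nonIso_mul (h1 : ∑ v, p v = 1) (f : ℝ → ℝ) :
    expect p (fun x : Fin n → Fin m => nonIso x * f (nonIso x)) =
      ∑ i : Fin n, ∑ b, (p b * hitProb n p b * expect p (fun x => f (nonIso (update x i b))) +
        ∑ j, expect p (fun x => weight p (.inr (i, j, b)) x *
          (f (nonIso (update (update x i b) j b)) - f (nonIso (update x i b))))) := by
  have e1 : (fun x : Fin n → Fin m => nonIso x * f (nonIso x)) = fun x => ∑ i, ∑ b,
      (if x i = b then (1 : ℝ) else 0) *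
        ((if 0 < others x i b then (1 : ℝ) else 0) * f (nonIso x)) := by
    funext x
    rw [show nonIso x * f (nonIso x) =
      (∑ i : Fin n, if 0 < companions x i then 1 else 0) * f (nonIso x) from rfl, Finset.sum_mul]
    refine Finset.sum_congr rfl fun i _ => ?_
    simp only [ite_mul, one_mul, zero_mul, Finset.sum_ite_eq, Finset.mem_univ, if_true]
    rw [companions_eq]
    simp
  rw [e1, expect_sum]
  refine Finset.sum_congr rfl fun i _ => ?_
  rw [expect_sum]
  refine Finset.sum_congr rfl fun b _ => ?_
  rw [expect_indicator_mul h1]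
  simp only [others_update_self, occupied_eq (p := p)]
  have e2 : (fun x : Fin n → Fin m => (hitProb n p b +
      ∑ j ∈ Finset.univ.erase i, (ind x j b - p b) * moveWeight p x i j b) *
        f (nonIso (update x i b))) = fun x => hitProb n p b * f (nonIso (update x i b)) +
      ∑ j ∈ Finset.univ.erase i, (ind x j b - p b) *
        (moveWeight p x i j b * f (nonIso (update x i b))) := by
    funext x
    rw [add_mul, Finset.sum_mul]
    simp only [mul_assoc]
  rw [e2, expect_add, expect_mul_left, expect_sum, mul_add, mul_assoc, Finset.mul_sum,
    ← Finset.sum_erase (a := i) Finset.univ (by simp [weight, expect])]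
  congr 1
  refine Finset.sum_congr rfl fun j hj => ?_
  have hji : j ≠ i := Finset.ne_of_mem_erase hj
  rw [expect_centered_ind_mul h1, ← mul_assoc, ← expect_mul_left]
  congr 1
  funext x
  simp only [weight, if_neg hji]
  rw [moveWeight_update_self, update_comm hji]
  ring

/-- The covariance identity behind the normal approximation. -/
theorem expect_nonIso_sub_mul (h1 : ∑ v, p v = 1) (f : ℝ → ℝ) :
    expect p (fun x : Fin n → Fin m => (nonIso x - expect p (nonIso (n := n))) * f (nonIso x)) =
      expect p (fun x => ∑ k : Move n m,
        weight p k x * (f (nonIso (after k x)) - f (nonIso (before k x)))) := by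
  -- For f = 1 all differences vanish and the mean is left. Subtracting μ f(Y) then completes each
  -- `hitProb` term to the difference of a one-ball move.
  have hμ : expect p (nonIso (n := n)) = ∑ _i : Fin n, ∑ b, p b * hitProb n p b := by
    have := expect_nonIso_mul (n := n) h1 (fun _ => 1)
    simp only [mul_one, expect_const h1, sub_self, mul_zero] at this
    rw [this]
    simp
  simp only [sub_mul]
  rw [expect_sub, expect_mul_left, expect_nonIso_mul h1, expect_sum, Fintype.sum_sum_type,
    Fintype.sum_prod_type, Fintype.sum_prod_type, hμ, Finset.sum_mul]
  simp only [Fintype.sum_prod_type, weight, before, after, Finset.sum_mul]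
  rw [← Finset.sum_sub_distrib, ← Finset.sum_add_distrib]
  refine Finset.sum_congr rfl fun i _ => ?_
  rw [Finset.sum_comm (s := (Finset.univ : Finset (Fin n))) (t := (Finset.univ : Finset (Fin m))),
    ← Finset.sum_sub_distrib, ← Finset.sum_add_distrib]
  refine Finset.sum_congr rfl fun b _ => ?_
  rw [expect_mul_left, expect_sub]
  ring

lemma weight_nonneg (h0 : ∀ b, 0 ≤ p b) (hp1 : ∀ b, p b ≤ 1) (k : Move n m) (x : Fin n → Fin m) :
    0 ≤ weight p k x := by
  rcases k with ⟨i, b⟩ | ⟨i, j, b⟩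
  · exact mul_nonneg (h0 b) (hitProb_nonneg h0 hp1 b)
  · simp only [weight]
    split_ifs
    · exact le_rfl
    · exact mul_nonneg (mul_nonneg (h0 b) (h0 b)) (moveWeight_nonneg hp1 x i j b)

lemma weight_inl_le (h0 : ∀ b, 0 ≤ p b) (hp1 : ∀ b, p b ≤ 1) (x : Fin n → Fin m) (i : Fin n)
    (b : Fin m) : weight p (.inl (i, b)) x ≤ n * p b ^ 2 := by
  have := mul_le_mul_of_nonneg_left (hitProb_le (n := n) h0 hp1 b) (h0 b)
  simp only [weight]
  linarith

lemma weight_inr_le (h0 : ∀ b, 0 ≤ p b) (hp1 : ∀ b, p b ≤ 1) (x : Fin n → Fin m) (i j : Fin n)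
    (b : Fin m) : weight p (.inr (i, j, b)) x ≤ p b ^ 2 := by
  simp only [weight]
  split_ifs
  · positivity
  · have := mul_le_mul_of_nonneg_left (moveWeight_le_one h0 hp1 x i j b) (mul_nonneg (h0 b) (h0 b))
    linarith

lemma sum_weight_le (h0 : ∀ b, 0 ≤ p b) (hp1 : ∀ b, p b ≤ 1) (x : Fin n → Fin m) :
    ∑ k : Move n m, weight p k x ≤ 2 * (n ^ 2 * ∑ b, p b ^ 2) := by
  rw [Fintype.sum_sum_type, Fintype.sum_prod_type, Fintype.sum_prod_type, two_mul]
  simp only [Fintype.sum_prod_type]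
  refine add_le_add ?_ ?_
  · calc _ ≤ ∑ _i : Fin n, ∑ b, n * p b ^ 2 := Finset.sum_le_sum fun i _ =>
          Finset.sum_le_sum fun b _ => weight_inl_le h0 hp1 x i b
      _ = _ := by rw [← Finset.mul_sum]; simp; ring
  · calc _ ≤ ∑ _i : Fin n, ∑ _j : Fin n, ∑ b, p b ^ 2 := Finset.sum_le_sum fun i _ =>
          Finset.sum_le_sum fun j _ => Finset.sum_le_sum fun b _ => weight_inr_le h0 hp1 x i j b
      _ = _ := by simp; ring

lemma abs_after_sub_before_le (k : Move n m) (x : Fin n → Fin m) :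
    |nonIso (after k x) - nonIso (before k x)| ≤ 2 := by
  rcases k with ⟨i, b⟩ | ⟨i, j, b⟩
  · exact abs_nonIso_update_sub_le _ _ _
  · exact abs_nonIso_update_sub_le _ _ _

lemma abs_before_sub_le (k : Move n m) (x : Fin n → Fin m) :
    |nonIso (before k x) - nonIso x| ≤ 2 := by
  rcases k with ⟨i, b⟩ | ⟨i, j, b⟩
  · simp [before]
  · exact abs_nonIso_update_sub_le _ _ _

lemma abs_after_sub_le (k : Move n m) (x : Fin n → Fin m) :
    |nonIso (after k x) - nonIso x| ≤ 4 := by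
  have h := abs_add_le (nonIso (after k x) - nonIso (before k x)) (nonIso (before k x) - nonIso x)
  rw [sub_add_sub_cancel] at h
  linarith [abs_after_sub_before_le k x, abs_before_sub_le k x]

end Coupling

/-! ### Fluctuations of the weighted increments -/

section CouplingVariance

variable {n m : ℕ} {p : Fin m → ℝ}

/-- The weighted sum of the increments of all moves. -/
def driftSum (p : Fin m → ℝ) (x : Fin n → Fin m) : ℝ :=
  ∑ k : Move n m, weight p k x * (nonIso (after k x) - nonIso (before k x))

/-- The part of `driftSum` due to moves to the urn `b`. -/
def driftAt (p : Fin m → ℝ) (b : Fin m) (x : Fin n → Fin m) : ℝ :=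
  ∑ i, (weight p (.inl (i, b)) x * (nonIso (update x i b) - nonIso x) +
    ∑ j, weight p (.inr (i, j, b)) x *
      (nonIso (update (update x i b) j b) - nonIso (update x i b)))

lemma driftSum_eq (x : Fin n → Fin m) : driftSum p x = ∑ b, driftAt p b x := by
  unfold driftSum driftAt
  rw [Fintype.sum_sum_type, Finset.sum_comm, Fintype.sum_prod_type, Fintype.sum_prod_type,
    ← Finset.sum_add_distrib]
  refine Finset.sum_congr rfl fun i _ => ?_
  rw [Finset.sum_add_distrib, Fintype.sum_prod_type, Finset.sum_comm (γ := Fin n)]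
  rfl

lemma abs_driftAt_le (h0 : ∀ b, 0 ≤ p b) (hp1 : ∀ b, p b ≤ 1) (b : Fin m) (x : Fin n → Fin m) :
    |driftAt p b x| ≤ 4 * n ^ 2 * p b ^ 2 := by
  unfold driftAt
  refine (Finset.abs_sum_le_sum_abs _ _).trans ?_
  calc _ ≤ ∑ _i : Fin n, (n * p b ^ 2 * 2 + ∑ _j : Fin n, p b ^ 2 * 2) := by
        refine Finset.sum_le_sum fun i _ => (abs_add_le _ _).trans (add_le_add ?_ ?_)
        · rw [abs_mul, abs_of_nonneg (weight_nonneg h0 hp1 _ _)]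
          exact mul_le_mul (weight_inl_le h0 hp1 x i b) (abs_nonIso_update_sub_le _ _ _)
            (abs_nonneg _) (by positivity)
        · refine (Finset.abs_sum_le_sum_abs _ _).trans (Finset.sum_le_sum fun j _ => ?_)
          rw [abs_mul, abs_of_nonneg (weight_nonneg h0 hp1 _ _)]
          exact mul_le_mul (weight_inr_le h0 hp1 x i j b) (abs_nonIso_update_sub_le _ _ _)
            (abs_nonneg _) (by positivity)
    _ = _ := by simp; ring

/-- The balls affected by moving ball `k` to the urn `c`. -/
def affected (x : Fin n → Fin m) (k : Fin n) (c : Fin m) : Finset (Fin n) :=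
  Finset.univ.filter fun i => i = k ∨ x i = x k ∨ x i = c

lemma card_affected_le (x : Fin n → Fin m) (k : Fin n) (c : Fin m) :
    (affected x k c).card ≤ 1 + others x k (x k) + others x k c := by
  have : affected x k c ⊆ ({k} ∪ Finset.univ.filter fun j => j ≠ k ∧ x j = x k) ∪
      Finset.univ.filter fun j => j ≠ k ∧ x j = c := by
    intro i hi
    simp only [affected, Finset.mem_filter, Finset.mem_univ, true_and] at hi
    simp only [Finset.mem_union, Finset.mem_singleton, Finset.mem_filter, Finset.mem_univ, true_and]
    tauto
  refine (Finset.card_le_card this).trans ((Finset.card_union_le _ _).trans ?_)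
  exact Nat.add_le_add_right ((Finset.card_union_le _ _).trans (by simp [others])) _

lemma weight_update_of_ne (x : Fin n → Fin m) (k i j : Fin n) (b c : Fin m) (hb : b ≠ x k)
    (hbc : b ≠ c) :
    weight p (.inr (i, j, b)) (update x k c) = weight p (.inr (i, j, b)) x := by
  simp only [weight, moveWeight_update x k i j b c hb hbc]

/-- Only the second ball j has to be unaffected. If i = k, the move of i overwrites that of k;
otherwise k still sits in x_k after i moves, and j = i is harmless because it then sits in b. -/
lemma increment_after_update (x : Fin n → Fin m) (k i j : Fin n) (b c : Fin m) (hb : b ≠ x k)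
    (hbc : b ≠ c) (hj : j ∉ affected x k c) :
    nonIso (update (update (update x k c) i b) j b) - nonIso (update (update x k c) i b) =
      nonIso (update (update x i b) j b) - nonIso (update x i b) := by
  simp only [affected, Finset.mem_filter, Finset.mem_univ, true_and, not_or] at hj
  by_cases hik : i = k
  · subst hik
    rw [update_idem]
  · rw [update_comm (Ne.symm hik)]
    have hk : update x i b k = x k := update_of_ne (Ne.symm hik) _ _
    have hjb : update x i b j ≠ x k ∧ update x i b j ≠ c := by
      by_cases hji : j = i
      · subst hji; simpa using ⟨hb, hbc⟩
      · rw [update_of_ne hji]; exact hj.2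
    exact nonIso_increment_update _ k j b c (by rwa [hk]) hbc hj.1 (by rw [hk]; exact hjb.1) hjb.2

lemma sum_ite_mem_const (s : Finset (Fin n)) (c : ℝ) :
    ∑ i, (if i ∈ s then c else 0) = s.card * c := by
  rw [Finset.sum_ite_mem, Finset.univ_inter, Finset.sum_const, nsmul_eq_mul]

lemma abs_driftAt_sub_le (h0 : ∀ b, 0 ≤ p b) (hp1 : ∀ b, p b ≤ 1) (x : Fin n → Fin m) (k : Fin n)
    (b c : Fin m) (hb : b ≠ x k) (hbc : b ≠ c) :
    |driftAt p b x - driftAt p b (update x k c)| ≤ 8 * n * p b ^ 2 * (affected x k c).card := by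
  have hd : ∀ (w d d' W : ℝ), 0 ≤ w → w ≤ W → |d| ≤ 2 → |d'| ≤ 2 → |w * d - w * d'| ≤ W * 4 := by
    intro w d d' W hw hwW h1 h2
    rw [← mul_sub, abs_mul, abs_of_nonneg hw]
    exact mul_le_mul hwW ((abs_sub _ _).trans (by linarith)) (abs_nonneg _) (hw.trans hwW)
  unfold driftAt
  rw [← Finset.sum_sub_distrib]
  refine (Finset.abs_sum_le_sum_abs _ _).trans ?_
  calc _ ≤ ∑ i : Fin n, ((if i ∈ affected x k c then n * p b ^ 2 * 4 else 0) +
        ∑ j : Fin n, if j ∈ affected x k c then p b ^ 2 * 4 else 0) := by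
        refine Finset.sum_le_sum fun i _ => ?_
        rw [add_sub_add_comm]
        refine (abs_add_le _ _).trans (add_le_add ?_ ?_)
        · rw [show weight p (.inl (i, b)) (update x k c) = weight p (.inl (i, b)) x from rfl]
          split_ifs with hi
          · exact hd _ _ _ _ (weight_nonneg h0 hp1 _ _) (weight_inl_le h0 hp1 x i b)
              (abs_nonIso_update_sub_le _ _ _) (abs_nonIso_update_sub_le _ _ _)
          · simp only [affected, Finset.mem_filter, Finset.mem_univ, true_and, not_or] at hi
            rw [nonIso_increment_update x k i b c hb hbc hi.1 hi.2.1 hi.2.2]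
            simp
        · rw [← Finset.sum_sub_distrib]
          refine (Finset.abs_sum_le_sum_abs _ _).trans (Finset.sum_le_sum fun j _ => ?_)
          rw [weight_update_of_ne x k i j b c hb hbc]
          split_ifs with hj
          · exact hd _ _ _ _ (weight_nonneg h0 hp1 _ _) (weight_inr_le h0 hp1 x i j b)
              (abs_nonIso_update_sub_le _ _ _) (abs_nonIso_update_sub_le _ _ _)
          · rw [increment_after_update x k i j b c hb hbc hj]
            simp
    _ = _ := by
        rw [Finset.sum_add_distrib, sum_ite_mem_const, sum_ite_mem_const]
        simp; ring

/-- For the urns x_k and c both values of `driftAt` are bounded crudely. For every other target urn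
the weights are unchanged and only the increments of affected balls can differ. -/
lemma abs_driftSum_sub_le (h0 : ∀ b, 0 ≤ p b) (hp1 : ∀ b, p b ≤ 1) (x : Fin n → Fin m)
    (k : Fin n) (c : Fin m) :
    |driftSum p x - driftSum p (update x k c)| ≤
      8 * n ^ 2 * (p (x k) ^ 2 + p c ^ 2) +
        8 * (n * ∑ b, p b ^ 2) * (1 + others x k (x k) + others x k c) := by
  have hcard : ((affected x k c).card : ℝ) ≤ 1 + others x k (x k) + others x k c := by
    exact_mod_cast card_affected_le x k c
  rw [driftSum_eq, driftSum_eq, ← Finset.sum_sub_distrib]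
  refine (Finset.abs_sum_le_sum_abs _ _).trans ?_
  calc _ ≤ ∑ b, (((if b = x k then 8 * n ^ 2 * p b ^ 2 else 0) +
        (if b = c then 8 * n ^ 2 * p b ^ 2 else 0)) +
          8 * n * p b ^ 2 * (affected x k c).card) := by
        refine Finset.sum_le_sum fun b _ => ?_
        have hpos : 0 ≤ 8 * n * p b ^ 2 * (affected x k c).card := by positivity
        have hpos2 : 0 ≤ 8 * n ^ 2 * p b ^ 2 := by positivity
        have hbig : |driftAt p b x - driftAt p b (update x k c)| ≤ 8 * n ^ 2 * p b ^ 2 := by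
          refine (abs_sub _ _).trans ?_
          linarith [abs_driftAt_le h0 hp1 b x, abs_driftAt_le h0 hp1 b (update x k c)]
        by_cases h1 : b = x k
        · rw [if_pos h1]
          split_ifs <;> linarith
        · by_cases h2 : b = c
          · rw [if_pos h2, if_neg h1]; linarith
          · rw [if_neg h1, if_neg h2]
            linarith [abs_driftAt_sub_le h0 hp1 x k b c h1 h2]
    _ = 8 * n ^ 2 * (p (x k) ^ 2 + p c ^ 2) +
          8 * (n * ∑ b, p b ^ 2) * (affected x k c).card := by
        rw [Finset.sum_add_distrib, Finset.sum_add_distrib, Finset.sum_ite_eq', Finset.sum_ite_eq',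
          ← Finset.sum_mul, ← Finset.mul_sum]
        simp; ring
    _ ≤ _ := by
        gcongr

lemma expect_ind_mul_ind_le (h1 : ∑ v, p v = 1) (j l : Fin n) (a : Fin m) :
    expect p (fun x => ind x j a * ind x l a) ≤ p a ^ 2 + if j = l then p a else 0 := by
  have h := expect_indicator_mul (p := p) h1 j a (fun x => ind x l a)
  simp only [ind] at h ⊢
  rw [h]
  split_ifs with hjl
  · subst hjl
    simp only [update_self, if_true, expect_const h1]
    nlinarith [sq_nonneg (p a)]
  · have h2 := expect_indicator_mul (p := p) h1 l a (fun _ => 1)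
    simp only [mul_one, expect_const h1] at h2
    simp only [update_of_ne (Ne.symm hjl), h2]
    rw [add_zero, sq]

lemma expect_others_sq_le (h0 : ∀ b, 0 ≤ p b) (h1 : ∑ v, p v = 1) (k : Fin n) (a : Fin m) :
    expect p (fun x => (others x k a : ℝ) ^ 2) ≤ (n * p a) ^ 2 + n * p a := by
  have hle : ∀ x : Fin n → Fin m, (others x k a : ℝ) ^ 2 ≤ ∑ j, ∑ l, ind x j a * ind x l a := by
    intro x
    have e : (others x k a : ℝ) ≤ ∑ j, ind x j a := by
      have hle' : others x k a ≤ (Finset.univ.filter fun j => x j = a).card :=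
        Finset.card_le_card fun j hj => by
          simp only [Finset.mem_filter, Finset.mem_univ, true_and] at hj ⊢
          exact hj.2
      have : ∑ j, ind x j a = ((Finset.univ.filter fun j => x j = a).card : ℝ) := by simp [ind]
      rw [this]
      exact_mod_cast hle'
    rw [← Finset.sum_mul_sum, ← sq]
    gcongr
  refine (expect_mono h0 hle).trans ?_
  rw [expect_sum]
  calc _ ≤ ∑ j : Fin n, ∑ l : Fin n, (p a ^ 2 + if j = l then p a else 0) := by
        refine Finset.sum_le_sum fun j _ => ?_
        rw [expect_sum]
        exact Finset.sum_le_sum fun l _ => expect_ind_mul_ind_le h1 j l a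
    _ = _ := by
        simp [Finset.sum_add_distrib]
        ring

/-- The pointwise bound is squared, and occupation numbers have second moment at most 2G². Since s =
n ∑ p_b² ≤ G, one factor s of s² is traded for G, which keeps the bound linear in s. -/
lemma expect_driftSum_sub_sq_le (h0 : ∀ b, 0 ≤ p b) (h1 : ∑ v, p v = 1) {G : ℝ} (hG : 1 ≤ G)
    (hpG : ∀ b, n * p b ≤ G) (k : Fin n) :
    ∑ c, p c * expect p (fun x => (driftSum p x - driftSum p (update x k c)) ^ 2) ≤
      2432 * G ^ 3 * (n * ∑ b, p b ^ 2) := by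
  have hp1 : ∀ b, p b ≤ 1 := fun b =>
    (Finset.single_le_sum (fun v _ => h0 v) (Finset.mem_univ b)).trans h1.le
  set s : ℝ := n * ∑ b, p b ^ 2 with hs
  have hs0 : 0 ≤ s := by positivity
  have hsG : s ≤ G := by
    calc s = ∑ b, p b * (n * p b) := by
          rw [hs, Finset.mul_sum]; exact Finset.sum_congr rfl fun b _ => by ring
      _ ≤ ∑ b, p b * G := Finset.sum_le_sum fun b _ => mul_le_mul_of_nonneg_left (hpG b) (h0 b)
      _ = G := by rw [← Finset.sum_mul, h1, one_mul]
  have hpt : ∀ (x : Fin n → Fin m) (c : Fin m),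
      (driftSum p x - driftSum p (update x k c)) ^ 2 ≤
        (256 * n ^ 4 * p (x k) ^ 4 + 384 * s ^ 2 * (others x k (x k) : ℝ) ^ 2) +
        (256 * n ^ 4 * p c ^ 4 + 384 * s ^ 2 * (others x k c : ℝ) ^ 2 + 384 * s ^ 2) := by
    intro x c
    have h := abs_driftSum_sub_le h0 hp1 x k c
    rw [← hs] at h
    rw [← sq_abs]
    have h2 := pow_le_pow_left₀ (abs_nonneg _) h 2
    refine h2.trans ?_
    set A := p (x k) ^ 2
    set B := p c ^ 2
    set o : ℝ := ((others x k (x k) : ℕ) : ℝ)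
    set o' : ℝ := ((others x k c : ℕ) : ℝ)
    have e1 : p (x k) ^ 4 = A ^ 2 := by simp only [A]; ring
    have e2 : p c ^ 4 = B ^ 2 := by simp only [B]; ring
    rw [e1, e2]
    have i1 : (A + B) ^ 2 ≤ 2 * (A ^ 2 + B ^ 2) := by nlinarith [sq_nonneg (A - B)]
    have i2 : (1 + o + o') ^ 2 ≤ 3 * (1 + o ^ 2 + o' ^ 2) := by
      nlinarith [sq_nonneg (o - o'), sq_nonneg (o - 1), sq_nonneg (o' - 1)]
    have i3 : ∀ u v : ℝ, (u + v) ^ 2 ≤ 2 * u ^ 2 + 2 * v ^ 2 := fun u v => by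
      nlinarith [sq_nonneg (u - v)]
    calc _ ≤ 2 * (8 * n ^ 2 * (A + B)) ^ 2 + 2 * (8 * s * (1 + o + o')) ^ 2 := i3 _ _
      _ = 128 * n ^ 4 * (A + B) ^ 2 + 128 * s ^ 2 * (1 + o + o') ^ 2 := by ring
      _ ≤ 128 * n ^ 4 * (2 * (A ^ 2 + B ^ 2)) + 128 * s ^ 2 * (3 * (1 + o ^ 2 + o' ^ 2)) := by
          gcongr
      _ = _ := by ring
  have hoG : ∀ a, expect p (fun x : Fin n → Fin m => (others x k a : ℝ) ^ 2) ≤ 2 * G ^ 2 := by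
    intro a
    refine (expect_others_sq_le h0 h1 k a).trans ?_
    have : 0 ≤ n * p a := mul_nonneg (by positivity) (h0 a)
    nlinarith [hpG a]
  have hsum4 : ∑ a, p a * (256 * n ^ 4 * p a ^ 4) ≤ 256 * G ^ 3 * s := by
    rw [hs, Finset.mul_sum, Finset.mul_sum]
    refine Finset.sum_le_sum fun a _ => ?_
    have h3 := pow_le_pow_left₀ (mul_nonneg (by positivity) (h0 a)) (hpG a) 3
    calc p a * (256 * n ^ 4 * p a ^ 4) = 256 * (n * p a) ^ 3 * (n * p a ^ 2) := by ring
      _ ≤ 256 * G ^ 3 * (n * p a ^ 2) := by gcongr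
  have hfirst : expect p (fun x => 256 * n ^ 4 * p (x k) ^ 4 +
      384 * s ^ 2 * (others x k (x k) : ℝ) ^ 2) ≤ 256 * G ^ 3 * s + 384 * s ^ 2 * (2 * G ^ 2) := by
    -- The urn x_k is random, but the count of other balls ignores ball k, so conditioning on x_k =
    -- a reduces to a fixed urn.
    rw [expect_resample h1 k]
    simp only [update_self, others_update_self]
    calc _ ≤ ∑ a, (p a * (256 * n ^ 4 * p a ^ 4) + p a * (384 * s ^ 2 * (2 * G ^ 2))) := by
          refine Finset.sum_le_sum fun a _ => ?_
          rw [← mul_add, expect_add, expect_const h1, expect_mul_left]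
          refine mul_le_mul_of_nonneg_left ?_ (h0 a)
          have := hoG a
          gcongr
      _ ≤ _ := by
          rw [Finset.sum_add_distrib, ← Finset.sum_mul, h1, one_mul]
          linarith
  calc _ ≤ ∑ c, (p c * (256 * G ^ 3 * s + 384 * s ^ 2 * (2 * G ^ 2)) +
        (p c * (256 * n ^ 4 * p c ^ 4) + p c * (384 * s ^ 2 * (2 * G ^ 2) + 384 * s ^ 2))) := by
        refine Finset.sum_le_sum fun c _ => ?_
        rw [← mul_add, ← mul_add]
        refine mul_le_mul_of_nonneg_left ?_ (h0 c)
        refine (expect_mono h0 fun x => hpt x c).trans ?_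
        rw [expect_add]
        refine add_le_add hfirst ?_
        rw [expect_add, expect_add, expect_const h1, expect_const h1, expect_mul_left]
        have := mul_le_mul_of_nonneg_left (hoG c) (by positivity : 0 ≤ 384 * s ^ 2)
        linarith
    _ ≤ (256 * G ^ 3 * s + 384 * s ^ 2 * (2 * G ^ 2)) +
        (256 * G ^ 3 * s + (384 * s ^ 2 * (2 * G ^ 2) + 384 * s ^ 2)) := by
        rw [Finset.sum_add_distrib, Finset.sum_add_distrib, ← Finset.sum_mul, ← Finset.sum_mul, h1,
          one_mul, one_mul]
        linarith
    _ = 512 * G ^ 3 * s + 384 * s * (s * (1 + 4 * G ^ 2)) := by ring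
    _ ≤ 512 * G ^ 3 * s + 384 * s * (G * (5 * G ^ 2)) := by
        have : 1 + 4 * G ^ 2 ≤ 5 * G ^ 2 := by nlinarith
        gcongr
    _ = _ := by ring

/-- The covariance identity with f the identity. -/
lemma expect_driftSum (h1 : ∑ v, p v = 1) :
    expect p (driftSum (n := n) p) =
      expect p (fun x : Fin n → Fin m => (nonIso x - expect p (nonIso (n := n))) ^ 2) := by
  have h := expect_nonIso_sub_mul (n := n) h1 (fun y => y)
  unfold driftSum
  rw [← h]
  have e : (fun x : Fin n → Fin m => (nonIso x - expect p (nonIso (n := n))) ^ 2) = fun x =>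
      (nonIso x - expect p (nonIso (n := n))) * nonIso x -
        expect p (nonIso (n := n)) * (nonIso x - expect p (nonIso (n := n))) := by
    funext x; ring
  rw [e, expect_sub, expect_mul_left, expect_sub, expect_const h1]
  simp

/-- The variance of the weighted sum of increments. -/
theorem variance_driftSum_le (h0 : ∀ b, 0 ≤ p b) (h1 : ∑ v, p v = 1) {G : ℝ} (hG : 1 ≤ G)
    (hpG : ∀ b, n * p b ≤ G) :
    expect p (fun x : Fin n → Fin m => (driftSum p x - expect p (driftSum (n := n) p)) ^ 2) ≤
      2432 * G ^ 3 * (n ^ 2 * ∑ b, p b ^ 2) := by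
  refine (efron_stein h0 h1 _).trans ?_
  calc _ ≤ ∑ _k : Fin n, 2432 * G ^ 3 * (n * ∑ b, p b ^ 2) :=
        Finset.sum_le_sum fun k _ => expect_driftSum_sub_sq_le h0 h1 hG hpG k
    _ = _ := by simp; ring

end CouplingVariance

/-! ### Test variables and their covariance with the count -/

section VarianceLower

variable {n m : ℕ} {p : Fin m → ℝ}

/-- The product over `A` of the centered indicators of the urn `z`. -/
def chi (p : Fin m → ℝ) (A : Finset (Fin n)) (z : Fin m) (x : Fin n → Fin m) : ℝ :=
  ∏ l ∈ A, (ind x l z - p z)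

/-- The covariance of the indicators of the urns `w` and `z` for one ball. -/
def urnCov (p : Fin m → ℝ) (w z : Fin m) : ℝ := (if w = z then p z else 0) - p w * p z

/-- The indicator that ball `i` is the only ball in urn `w`. -/
def alone (x : Fin n → Fin m) (i : Fin n) (w : Fin m) : ℝ :=
  ind x i w * ∏ j ∈ Finset.univ.erase i, (1 - ind x j w)

lemma sum_mul_centered (h1 : ∑ v, p v = 1) (z : Fin m) :
    ∑ v, p v * ((if v = z then (1 : ℝ) else 0) - p z) = 0 := by
  simp [mul_sub, Finset.sum_sub_distrib, ← Finset.sum_mul, h1]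

lemma sum_mul_ind_centered (w z : Fin m) :
    ∑ v, p v * ((if v = w then (1 : ℝ) else 0) * ((if v = z then (1 : ℝ) else 0) - p z)) =
      urnCov p w z := by
  unfold urnCov
  rw [Finset.sum_eq_single w]
  · simp only [if_true, one_mul, mul_sub, mul_ite, mul_one, mul_zero]
    split_ifs with h
    · rw [h]
    · rfl
  · intro v _ hv
    simp [hv]
  · simp

lemma sum_mul_centered_centered (h1 : ∑ v, p v = 1) (w z : Fin m) :
    ∑ v, p v * (((if v = w then (1 : ℝ) else 0) - p w) * ((if v = z then (1 : ℝ) else 0) - p z)) =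
      urnCov p w z := by
  have e : ∀ v, p v * (((if v = w then (1 : ℝ) else 0) - p w) *
      ((if v = z then (1 : ℝ) else 0) - p z)) =
      p v * ((if v = w then (1 : ℝ) else 0) * ((if v = z then (1 : ℝ) else 0) - p z)) -
        p w * (p v * ((if v = z then (1 : ℝ) else 0) - p z)) := fun v => by ring
  simp only [e, Finset.sum_sub_distrib]
  rw [← Finset.mul_sum, sum_mul_centered h1, sum_mul_ind_centered]
  ring

lemma chi_eq_prod (A : Finset (Fin n)) (z : Fin m) (x : Fin n → Fin m) :
    chi p A z x = ∏ j, if j ∈ A then (if x j = z then (1 : ℝ) else 0) - p z else 1 := by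
  rw [chi, Finset.prod_ite_mem, Finset.univ_inter]
  rfl

/-- Independence factorises over balls: a ball in exactly one of A and B contributes a centred
factor of mean zero, a common ball contributes the covariance. -/
lemma expect_chi_mul_chi (h1 : ∑ v, p v = 1) (A B : Finset (Fin n)) (w z : Fin m) :
    expect p (fun x => chi p A w x * chi p B z x) = if A = B then urnCov p w z ^ A.card else 0 := by
  set g : Fin n → Fin m → ℝ := fun j v =>
    (if j ∈ A then (if v = w then (1 : ℝ) else 0) - p w else 1) *
      (if j ∈ B then (if v = z then (1 : ℝ) else 0) - p z else 1) with hg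
  have e : (fun x => chi p A w x * chi p B z x) = fun x : Fin n → Fin m => ∏ j, g j (x j) := by
    funext x
    rw [chi_eq_prod, chi_eq_prod, ← Finset.prod_mul_distrib]
  rw [e, expect_prod]
  simp only [hg]
  split_ifs with hAB
  · subst hAB
    rw [← Finset.prod_const, ← Finset.univ_inter A, ← Finset.prod_ite_mem, Finset.univ_inter]
    refine Finset.prod_congr rfl fun j _ => ?_
    by_cases hj : j ∈ A
    · simp only [if_pos hj]
      exact sum_mul_centered_centered h1 w z
    · simp only [if_neg hj, mul_one, h1]
  · obtain ⟨j, hj⟩ : ∃ j, ¬(j ∈ A ↔ j ∈ B) := by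
      by_contra hcon
      push Not at hcon
      exact hAB (Finset.ext hcon)
    refine Finset.prod_eq_zero (Finset.mem_univ j) ?_
    by_cases hA : j ∈ A
    · have hB : j ∉ B := fun hB => hj (by simp [hA, hB])
      simp only [if_pos hA, if_neg hB, mul_one]
      exact sum_mul_centered h1 w
    · have hB : j ∈ B := by by_contra hB; exact hj (by simp [hA, hB])
      simp only [if_pos hB, if_neg hA, one_mul]
      exact sum_mul_centered h1 z

lemma expect_chi (h1 : ∑ v, p v = 1) (A : Finset (Fin n)) (hA : A.Nonempty) (z : Fin m) :
    expect p (chi p A z) = 0 := by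
  have h := expect_chi_mul_chi h1 A ∅ z z
  rw [if_neg hA.ne_empty] at h
  simp only [chi, Finset.prod_empty, mul_one] at h
  exact h

/-- Factorise over balls. Ball i gives the covariance or p w according to membership in A; every
other ball gives minus the covariance if in A and 1 - p w if not. -/
lemma expect_alone_mul_chi (h1 : ∑ v, p v = 1) (A : Finset (Fin n)) (i : Fin n) (w z : Fin m) :
    expect p (fun x => alone x i w * chi p A z x) =
      if i ∈ A then urnCov p w z * ((-urnCov p w z) ^ (A.card - 1) * (1 - p w) ^ (n - A.card))
      else p w * ((-urnCov p w z) ^ A.card * (1 - p w) ^ (n - A.card - 1)) := by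
  set g : Fin n → Fin m → ℝ := fun j v =>
    (if j = i then (if v = w then (1 : ℝ) else 0) else 1 - if v = w then (1 : ℝ) else 0) *
      (if j ∈ A then (if v = z then (1 : ℝ) else 0) - p z else 1) with hg
  have e : (fun x => alone x i w * chi p A z x) = fun x : Fin n → Fin m => ∏ j, g j (x j) := by
    funext x
    simp only [hg]
    rw [chi_eq_prod, Finset.prod_mul_distrib]
    congr 1
    rw [← Finset.mul_prod_erase _ _ (Finset.mem_univ i), alone, if_pos rfl]
    congr 1
    exact Finset.prod_congr rfl fun j hj => by rw [if_neg (Finset.ne_of_mem_erase hj)]; rfl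
  have hpw : ∑ v, p v * (if v = w then (1 : ℝ) else 0) = p w := by simp
  have hq : ∑ v, p v * (1 - if v = w then (1 : ℝ) else 0) = 1 - p w := by
    simp [mul_sub, Finset.sum_sub_distrib, h1]
  have hc : ∑ v, p v * ((1 - if v = w then (1 : ℝ) else 0) *
      ((if v = z then (1 : ℝ) else 0) - p z)) = -urnCov p w z := by
    have e3 : ∀ v, p v * ((1 - if v = w then (1 : ℝ) else 0) *
        ((if v = z then (1 : ℝ) else 0) - p z)) = p v * ((if v = z then (1 : ℝ) else 0) - p z) -
        p v * ((if v = w then (1 : ℝ) else 0) * ((if v = z then (1 : ℝ) else 0) - p z)) :=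
      fun v => by ring
    rw [Finset.sum_congr rfl fun v _ => e3 v, Finset.sum_sub_distrib, sum_mul_centered h1,
      sum_mul_ind_centered, zero_sub]
  rw [e, expect_prod]
  simp only [hg]
  rw [← Finset.mul_prod_erase _ _ (Finset.mem_univ i)]
  have hrest : ∏ j ∈ Finset.univ.erase i, ∑ v, p v *
      ((if j = i then (if v = w then (1 : ℝ) else 0) else 1 - if v = w then (1 : ℝ) else 0) *
          (if j ∈ A then (if v = z then (1 : ℝ) else 0) - p z else 1)) =
      ∏ j ∈ Finset.univ.erase i, if j ∈ A then -urnCov p w z else 1 - p w := by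
    refine Finset.prod_congr rfl fun j hj => ?_
    simp only [if_neg (Finset.ne_of_mem_erase hj)]
    by_cases hjA : j ∈ A
    · simp only [if_pos hjA]; exact hc
    · simp only [if_neg hjA, mul_one]; exact hq
  rw [hrest, Finset.prod_ite, Finset.prod_const, Finset.prod_const]
  have hf1 : (Finset.univ.erase i).filter (fun j => j ∈ A) = A.erase i := by
    ext j; simp [and_comm]
  have hf2 : (Finset.univ.erase i).filter (fun j => j ∉ A) = Aᶜ.erase i := by
    ext j; simp [and_comm]
  rw [hf1, hf2]
  simp only [if_true]
  by_cases hi : i ∈ A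
  · have hi' : i ∉ Aᶜ := by simpa using hi
    simp only [if_pos hi]
    rw [sum_mul_ind_centered, Finset.card_erase_of_mem hi, Finset.erase_eq_of_notMem hi',
      Finset.card_compl, Fintype.card_fin]
  · have hi' : i ∈ Aᶜ := by simpa using hi
    simp only [if_neg hi, mul_one]
    rw [hpw, Finset.card_erase_of_mem hi', Finset.erase_eq_of_notMem hi,
      Finset.card_compl, Fintype.card_fin]

/-- With r the size of A, r balls lie in A and n - r outside; the common factor is multiplied by -r
(1 - p w) + (n - r) p w = n p w - r. -/
lemma sum_expect_alone_mul_chi (h1 : ∑ v, p v = 1) (A : Finset (Fin n)) (w z : Fin m)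
    (hA0 : 0 < A.card) (hAn : A.card < n) :
    ∑ i, expect p (fun x => alone x i w * chi p A z x) =
      (-urnCov p w z) ^ A.card * (1 - p w) ^ (n - A.card - 1) * (n * p w - A.card) := by
  simp only [expect_alone_mul_chi h1]
  rw [Finset.sum_ite, Finset.sum_const, Finset.sum_const]
  have hf1 : Finset.univ.filter (fun j => j ∈ A) = A := by ext j; simp
  have hf2 : Finset.univ.filter (fun j => j ∉ A) = Aᶜ := by ext j; simp
  rw [hf1, hf2, Finset.card_compl, Fintype.card_fin, nsmul_eq_mul, nsmul_eq_mul,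
    Nat.cast_sub hAn.le]
  obtain ⟨r, hr⟩ : ∃ r, A.card = r + 1 := ⟨A.card - 1, by omega⟩
  obtain ⟨d, hd⟩ : ∃ d, n - A.card = d + 1 := ⟨n - A.card - 1, by omega⟩
  rw [hd, hr]
  simp only [Nat.add_sub_cancel, pow_succ]
  push_cast
  ring

lemma nonIso_eq_sub_alone (x : Fin n → Fin m) : nonIso x = n - ∑ w, ∑ i, alone x i w := by
  have hone : ∀ i, (if 0 < companions x i then (1 : ℝ) else 0) = 1 - ∑ w, alone x i w := by
    intro i
    have e : ∑ w, alone x i w = ∏ j ∈ Finset.univ.erase i, (1 - ind x j (x i)) := by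
      rw [Finset.sum_eq_single (x i)]
      · simp [alone, ind]
      · intro w _ hw
        simp [alone, ind, Ne.symm hw]
      · simp
    rw [e, companions_eq]
    by_cases ho : 0 < others x i (x i)
    · obtain ⟨j, hj⟩ := Finset.card_pos.1 ho
      simp only [Finset.mem_filter, Finset.mem_univ, true_and] at hj
      rw [if_pos (by exact_mod_cast ho),
        Finset.prod_eq_zero (Finset.mem_erase.2 ⟨hj.1, Finset.mem_univ j⟩) (by simp [ind, hj.2]),
        sub_zero]
    · rw [if_neg (by exact_mod_cast ho), Finset.prod_eq_one, sub_self]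
      intro j hj
      have hne : x j ≠ x i := by
        intro hxb
        refine ho (Finset.card_pos.2 ⟨j, ?_⟩)
        simpa using ⟨Finset.ne_of_mem_erase hj, hxb⟩
      simp [ind, hne]
  rw [nonIso, Finset.sum_congr rfl fun i _ => hone i, Finset.sum_sub_distrib,
    Finset.sum_comm (γ := Fin m)]
  simp

/-- The test variable of order `r` with urn coefficients `ε`. -/
def testVar (p : Fin m → ℝ) (r : ℕ) (ε : Fin m → ℝ) (x : Fin n → Fin m) : ℝ :=
  ∑ z, ε z * ∑ A ∈ Finset.univ.powersetCard r, chi p A z x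

lemma expect_testVar (h1 : ∑ v, p v = 1) {r : ℕ} (hr : 0 < r) (ε : Fin m → ℝ) :
    expect p (testVar (n := n) p r ε) = 0 := by
  unfold testVar
  rw [expect_sum]
  refine Finset.sum_eq_zero fun z _ => ?_
  rw [expect_mul_left, expect_sum, Finset.sum_eq_zero, mul_zero]
  intro A hA
  refine expect_chi h1 A (Finset.card_pos.1 ?_) z
  rw [(Finset.mem_powersetCard.1 hA).2]
  exact hr

lemma expect_testVar_sq (h1 : ∑ v, p v = 1) (r : ℕ) (ε : Fin m → ℝ) :
    expect p (fun x : Fin n → Fin m => testVar p r ε x ^ 2) =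
      n.choose r * ∑ z, ∑ w, ε z * ε w * urnCov p z w ^ r := by
  have e : (fun x : Fin n → Fin m => testVar p r ε x ^ 2) = fun x => ∑ z, ∑ w,
      ε z * ε w * ∑ A ∈ Finset.univ.powersetCard r, ∑ B ∈ Finset.univ.powersetCard r,
        chi p A z x * chi p B w x := by
    funext x
    rw [testVar, sq, Finset.sum_mul_sum]
    refine Finset.sum_congr rfl fun z _ => Finset.sum_congr rfl fun w _ => ?_
    rw [mul_mul_mul_comm, Finset.sum_mul_sum]
  rw [e, expect_sum, Finset.mul_sum]
  refine Finset.sum_congr rfl fun z _ => ?_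
  rw [expect_sum, Finset.mul_sum]
  refine Finset.sum_congr rfl fun w _ => ?_
  rw [expect_mul_left, expect_sum]
  have : ∀ A ∈ Finset.powersetCard r (Finset.univ : Finset (Fin n)),
      expect p (fun x => ∑ B ∈ Finset.univ.powersetCard r, chi p A z x * chi p B w x) =
        urnCov p z w ^ r := by
    intro A hA
    rw [expect_sum, Finset.sum_congr rfl fun B _ => expect_chi_mul_chi h1 A B z w,
      Finset.sum_ite_eq, if_pos hA, (Finset.mem_powersetCard.1 hA).2]
  rw [Finset.sum_congr rfl this, Finset.sum_const, Finset.card_powersetCard, Finset.card_univ,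
    Fintype.card_fin, nsmul_eq_mul]
  ring

lemma expect_nonIso_mul_testVar (h1 : ∑ v, p v = 1) {r : ℕ} (hr : 0 < r) (hrn : r < n)
    (ε : Fin m → ℝ) :
    expect p (fun x : Fin n → Fin m => nonIso x * testVar p r ε x) =
      -(n.choose r * ∑ z, ε z * ∑ w,
        (-urnCov p w z) ^ r * (1 - p w) ^ (n - r - 1) * (n * p w - r)) := by
  have e : (fun x : Fin n → Fin m => nonIso x * testVar p r ε x) = fun x =>
      n * testVar p r ε x - ∑ z, ε z * ∑ A ∈ Finset.univ.powersetCard r, ∑ w, ∑ i,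
        alone x i w * chi p A z x := by
    funext x
    have e2 : ∑ z, ε z * ∑ A ∈ Finset.univ.powersetCard r, ∑ w, ∑ i,
        alone x i w * chi p A z x = (∑ w, ∑ i, alone x i w) * testVar p r ε x := by
      simp only [testVar, ← Finset.sum_mul, ← Finset.mul_sum]
      rw [Finset.mul_sum]
      refine Finset.sum_congr rfl fun z _ => ?_
      ring
    rw [e2, nonIso_eq_sub_alone]
    ring
  rw [e, expect_sub, expect_mul_left, expect_testVar h1 hr, mul_zero, zero_sub, expect_sum,
    Finset.mul_sum]
  congr 1
  refine Finset.sum_congr rfl fun z _ => ?_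
  rw [expect_mul_left, expect_sum]
  have : ∀ A ∈ Finset.powersetCard r (Finset.univ : Finset (Fin n)),
      expect p (fun x => ∑ w, ∑ i, alone x i w * chi p A z x) =
        ∑ w, (-urnCov p w z) ^ r * (1 - p w) ^ (n - r - 1) * (n * p w - r) := by
    intro A hA
    have hcard := (Finset.mem_powersetCard.1 hA).2
    rw [expect_sum]
    refine Finset.sum_congr rfl fun w _ => ?_
    rw [expect_sum, sum_expect_alone_mul_chi h1 A w z (by omega) (by omega), hcard]
  rw [Finset.sum_congr rfl this, Finset.sum_const, Finset.card_powersetCard, Finset.card_univ,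
    Fintype.card_fin, nsmul_eq_mul]
  ring

end VarianceLower

/-! ### Lower bound for the variance -/

section VarianceLowerBound

variable {n m : ℕ} {p : Fin m → ℝ}

/-- The sign of `n p_z - r` (up to a global sign), set to zero when `n p_z` is close to `r`. -/
def testSign (n : ℕ) (p : Fin m → ℝ) (r : ℕ) (z : Fin m) : ℝ :=
  if 1 / 2 ≤ n * p z - r then (-1) ^ r else if n * p z - r ≤ -(1 / 2) then -(-1) ^ r else 0

/-- The indicator that `n p_z` is not close to `r`. -/
def farInd (n : ℕ) (p : Fin m → ℝ) (r : ℕ) (z : Fin m) : ℝ :=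
  if 1 / 2 ≤ |n * p z - r| then 1 else 0

lemma farInd_nonneg (r : ℕ) (z : Fin m) : 0 ≤ farInd n p r z := by
  unfold farInd; split_ifs <;> norm_num

lemma farInd_le_one (r : ℕ) (z : Fin m) : farInd n p r z ≤ 1 := by
  unfold farInd; split_ifs <;> norm_num

lemma abs_testSign (r : ℕ) (z : Fin m) : |testSign n p r z| = farInd n p r z := by
  unfold testSign farInd
  by_cases h1 : 1 / 2 ≤ n * p z - r
  · rw [if_pos h1, if_pos (h1.trans (le_abs_self _))]; simp
  · rw [if_neg h1]
    by_cases h2 : n * p z - r ≤ -(1 / 2)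
    · rw [if_pos h2, if_pos (by rw [abs_of_neg (by linarith)]; linarith)]; simp
    · rw [if_neg h2, if_neg (by rw [not_le, abs_lt]; constructor <;> linarith)]; simp

lemma half_farInd_le (r : ℕ) (z : Fin m) :
    farInd n p r z * (1 / 2) ≤ testSign n p r z * ((-1) ^ r * (n * p z - r)) := by
  have hs : ((-1 : ℝ) ^ r) * (-1) ^ r = 1 := by rw [← mul_pow]; simp
  unfold testSign farInd
  by_cases h1 : 1 / 2 ≤ n * p z - r
  · rw [if_pos h1, if_pos (h1.trans (le_abs_self _)), ← mul_assoc, hs]; linarith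
  · rw [if_neg h1]
    by_cases h2 : n * p z - r ≤ -(1 / 2)
    · rw [if_pos h2, if_pos (by rw [abs_of_neg (by linarith)]; linarith), neg_mul, ← mul_assoc, hs]
      linarith
    · rw [if_neg h2, if_neg (by rw [not_le, abs_lt]; constructor <;> linarith)]; simp

lemma urnCov_self (z : Fin m) : urnCov p z z = p z * (1 - p z) := by
  simp [urnCov]; ring

lemma urnCov_of_ne {w z : Fin m} (h : w ≠ z) : urnCov p w z = -(p w * p z) := by
  simp [urnCov, h]

/-- The sign makes the diagonal term w = z at least p_z^r θ/2 when n p_z is far from r. Off-diagonal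
terms carry p_w^r p_z^r with r ≥ 2, and `hn` makes their sum at most p_z^r θ/100; hence 49/100. -/
lemma testSign_mul_sum_ge (h0 : ∀ b, 0 ≤ p b) (h1 : ∑ v, p v = 1) {G θ : ℝ} (hG : 1 ≤ G)
    (hpG : ∀ b, n * p b ≤ G) (hθ : ∀ z, θ ≤ (1 - p z) ^ (n - 1))
    (hn : 400 * G ^ 2 ≤ n * θ) {r : ℕ} (hr2 : 2 ≤ r) (hr3 : r ≤ 3) (hrn : r < n) (z : Fin m) :
    farInd n p r z * p z ^ r * (49 / 100 * θ) ≤ testSign n p r z * ∑ w,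
      (-urnCov p w z) ^ r * (1 - p w) ^ (n - r - 1) * (n * p w - r) := by
  have hp1 : ∀ b, p b ≤ 1 := fun b =>
    (Finset.single_le_sum (fun v _ => h0 v) (Finset.mem_univ b)).trans h1.le
  have hn0 : (0 : ℝ) < n := by exact_mod_cast (by omega : 0 < n)
  have hr3' : (r : ℝ) ≤ 3 := by exact_mod_cast hr3
  rw [← Finset.add_sum_erase _ _ (Finset.mem_univ z), mul_add]
  have hdiag : (-urnCov p z z) ^ r * (1 - p z) ^ (n - r - 1) * (n * p z - r) =
      p z ^ r * (1 - p z) ^ (n - 1) * ((-1) ^ r * (n * p z - r)) := by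
    rw [urnCov_self, neg_pow, mul_pow, show n - 1 = r + (n - r - 1) by omega, pow_add]
    ring
  have hoff : |∑ w ∈ Finset.univ.erase z,
      (-urnCov p w z) ^ r * (1 - p w) ^ (n - r - 1) * (n * p w - r)| ≤
      p z ^ r * (θ / 100) := by
    refine (Finset.abs_sum_le_sum_abs _ _).trans ?_
    calc _ ≤ ∑ w ∈ Finset.univ.erase z, p z ^ r * (θ / 100 * p w) := by
          refine Finset.sum_le_sum fun w hw => ?_
          rw [urnCov_of_ne (Finset.ne_of_mem_erase hw), neg_neg, abs_mul, abs_mul,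
            abs_of_nonneg (pow_nonneg (mul_nonneg (h0 w) (h0 z)) r),
            abs_of_nonneg (pow_nonneg (by linarith [hp1 w]) _), mul_pow]
          have i1 : (1 - p w) ^ (n - r - 1) ≤ 1 :=
            pow_le_one₀ (by linarith [hp1 w]) (by linarith [h0 w])
          have hnp : 0 ≤ n * p w := mul_nonneg hn0.le (h0 w)
          have hr0 : (0 : ℝ) ≤ r := Nat.cast_nonneg r
          have i2 : |n * p w - r| ≤ 4 * G := by
            rw [abs_le]; constructor <;> linarith [hpG w]
          have i3 : p w ^ r ≤ p w ^ 2 := pow_le_pow_of_le_one (h0 w) (hp1 w) hr2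
          have i4 : p w ^ 2 * (4 * G) ≤ θ / 100 * p w := by
            have a1 : n * p w * (4 * G) ≤ G * (4 * G) := by
              have := hpG w
              gcongr
            have a2 : n * (p w * (4 * G)) ≤ n * (θ / 100) := by nlinarith
            have a3 := le_of_mul_le_mul_left a2 hn0
            nlinarith [h0 w]
          have hz := pow_nonneg (h0 z) r
          have hw0 := pow_nonneg (h0 w) r
          calc p w ^ r * p z ^ r * (1 - p w) ^ (n - r - 1) * |n * p w - r|
              ≤ p w ^ r * p z ^ r * 1 * (4 * G) := by gcongr
            _ = p z ^ r * (p w ^ r * (4 * G)) := by ring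
            _ ≤ p z ^ r * (p w ^ 2 * (4 * G)) := by gcongr
            _ ≤ _ := by gcongr
      _ = p z ^ r * (θ / 100) * ∑ w ∈ Finset.univ.erase z, p w := by
          rw [Finset.mul_sum]
          exact Finset.sum_congr rfl fun w _ => by ring
      _ ≤ p z ^ r * (θ / 100) * 1 := by
          have hθ0 : 0 ≤ θ := by
            have : 0 ≤ n * θ := le_trans (by positivity) hn
            exact nonneg_of_mul_nonneg_right this hn0
          have hz := pow_nonneg (h0 z) r
          refine mul_le_mul_of_nonneg_left ?_ (by positivity)
          rw [← h1]
          exact Finset.sum_le_sum_of_subset_of_nonneg (Finset.erase_subset _ _) fun v _ _ => h0 v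
      _ = _ := by ring
  have hz := pow_nonneg (h0 z) r
  have hf := farInd_nonneg (n := n) (p := p) r z
  have hoff2 : -(farInd n p r z * (p z ^ r * (θ / 100))) ≤ testSign n p r z *
      ∑ w ∈ Finset.univ.erase z, (-urnCov p w z) ^ r * (1 - p w) ^ (n - r - 1) * (n * p w - r) := by
    refine le_trans ?_ (neg_abs_le _)
    rw [abs_mul, abs_testSign]
    exact neg_le_neg (mul_le_mul_of_nonneg_left hoff hf)
  have hdiag2 : farInd n p r z * p z ^ r * (θ / 2) ≤
      testSign n p r z * ((-urnCov p z z) ^ r * (1 - p z) ^ (n - r - 1) * (n * p z - r)) := by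
    rw [hdiag]
    have hθz := hθ z
    calc farInd n p r z * p z ^ r * (θ / 2) = p z ^ r * θ * (farInd n p r z * (1 / 2)) := by ring
      _ ≤ p z ^ r * (1 - p z) ^ (n - 1) * (farInd n p r z * (1 / 2)) := by gcongr
      _ ≤ p z ^ r * (1 - p z) ^ (n - 1) * (testSign n p r z * ((-1) ^ r * (n * p z - r))) := by
          refine mul_le_mul_of_nonneg_left (half_farInd_le r z) (mul_nonneg hz ?_)
          exact pow_nonneg (by linarith [hp1 z]) _
      _ = _ := by ring
  linarith

/-- Diagonal terms sum to at most A = ∑ `farInd` · p^r and off-diagonal ones to at most A², with A ≤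
1. -/
lemma sum_testSign_urnCov_le (h0 : ∀ b, 0 ≤ p b) (h1 : ∑ v, p v = 1) {r : ℕ} (hr : 1 ≤ r) :
    ∑ z, ∑ w, testSign n p r z * testSign n p r w * urnCov p z w ^ r ≤
      2 * ∑ z, farInd n p r z * p z ^ r := by
  have hp1 : ∀ b, p b ≤ 1 := fun b =>
    (Finset.single_le_sum (fun v _ => h0 v) (Finset.mem_univ b)).trans h1.le
  have hf := farInd_nonneg (n := n) (p := p) r
  have hf1 := farInd_le_one (n := n) (p := p) r
  have hpr : ∀ z, 0 ≤ p z ^ r := fun z => pow_nonneg (h0 z) r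
  set A := ∑ z, farInd n p r z * p z ^ r with hA
  have hA0 : 0 ≤ A := Finset.sum_nonneg fun z _ => mul_nonneg (hf z) (hpr z)
  have hA1 : A ≤ 1 := by
    rw [← h1]
    refine Finset.sum_le_sum fun z _ => ?_
    calc _ ≤ 1 * p z ^ r := mul_le_mul_of_nonneg_right (hf1 z) (hpr z)
      _ ≤ p z := by rw [one_mul]; exact pow_le_of_le_one (h0 z) (hp1 z) (by omega)
  calc _ ≤ ∑ z, ∑ w, ((if z = w then farInd n p r z * p z ^ r else 0) +
        (farInd n p r z * p z ^ r) * (farInd n p r w * p w ^ r)) := by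
        refine Finset.sum_le_sum fun z _ => Finset.sum_le_sum fun w _ => ?_
        refine (le_abs_self _).trans ?_
        rw [abs_mul, abs_mul, abs_testSign, abs_testSign, abs_pow]
        by_cases hzw : z = w
        · subst hzw
          rw [if_pos rfl, urnCov_self, abs_of_nonneg (mul_nonneg (h0 z) (by linarith [hp1 z]))]
          have i1 : (p z * (1 - p z)) ^ r ≤ p z ^ r :=
            pow_le_pow_left₀ (mul_nonneg (h0 z) (by linarith [hp1 z]))
              (mul_le_of_le_one_right (h0 z) (by linarith [h0 z])) r
          have i2 : farInd n p r z * farInd n p r z ≤ farInd n p r z :=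
            mul_le_of_le_one_right (hf z) (hf1 z)
          have i3 : 0 ≤ (farInd n p r z * p z ^ r) * (farInd n p r z * p z ^ r) :=
            mul_self_nonneg _
          have i4 := mul_le_mul i2 i1
            (pow_nonneg (mul_nonneg (h0 z) (by linarith [hp1 z])) r) (hf z)
          linarith
        · rw [if_neg hzw, urnCov_of_ne hzw, abs_neg, abs_of_nonneg (mul_nonneg (h0 z) (h0 w)),
            mul_pow]
          apply le_of_eq; ring
    _ = A + A * A := by
        simp only [Finset.sum_add_distrib, Finset.sum_ite_eq, Finset.mem_univ, if_true]
        rw [← Finset.sum_mul_sum]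
    _ ≤ 2 * A := by nlinarith

/-- Cauchy–Schwarz for the centred count against the test variable, whose second moment is at most
2CA. Dividing by CA leaves the factor 2/0.49² < 9. -/
lemma choose_mul_sum_far_le (h0 : ∀ b, 0 ≤ p b) (h1 : ∑ v, p v = 1) {G θ : ℝ} (hG : 1 ≤ G)
    (hpG : ∀ b, n * p b ≤ G) (hθ : ∀ z, θ ≤ (1 - p z) ^ (n - 1)) (hθ0 : 0 < θ)
    (hn : 400 * G ^ 2 ≤ n * θ) {r : ℕ} (hr2 : 2 ≤ r) (hr3 : r ≤ 3) (hrn : r < n) :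
    n.choose r * (∑ z, farInd n p r z * p z ^ r) * θ ^ 2 ≤
      9 * expect p (fun x : Fin n → Fin m => (nonIso x - expect p (nonIso (n := n))) ^ 2) := by
  set A := ∑ z, farInd n p r z * p z ^ r with hA
  have hA0 : 0 ≤ A := Finset.sum_nonneg fun z _ =>
    mul_nonneg (farInd_nonneg r z) (pow_nonneg (h0 z) r)
  set C : ℝ := ((n.choose r : ℕ) : ℝ) with hC
  have hC0 : 0 ≤ C := Nat.cast_nonneg _
  set Vr := expect p (fun x : Fin n → Fin m => (nonIso x - expect p (nonIso (n := n))) ^ 2) with hVr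
  have hVr0 : 0 ≤ Vr := expect_nonneg h0 fun x => sq_nonneg _
  set T : (Fin n → Fin m) → ℝ := testVar p r (testSign n p r) with hT
  have hcov : expect p (fun x => (nonIso x - expect p (nonIso (n := n))) * T x) =
      expect p (fun x => nonIso x * T x) := by
    simp only [sub_mul]
    rw [expect_sub, expect_mul_left, hT, expect_testVar h1 (by omega), mul_zero, sub_zero]
  have hcs := expect_mul_sq_le h0 (fun x => nonIso x - expect p (nonIso (n := n))) T
  rw [hcov, ← hVr] at hcs
  have hE2 : expect p (fun x => T x ^ 2) ≤ C * (2 * A) := by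
    rw [hT, expect_testVar_sq h1]
    exact mul_le_mul_of_nonneg_left (sum_testSign_urnCov_le h0 h1 (by omega)) hC0
  have hE1 : C * A * (49 / 100 * θ) ≤ -expect p (fun x => nonIso x * T x) := by
    rw [hT, expect_nonIso_mul_testVar h1 (by omega) hrn, neg_neg, mul_assoc]
    refine mul_le_mul_of_nonneg_left ?_ hC0
    rw [hA, Finset.sum_mul]
    exact Finset.sum_le_sum fun z _ => testSign_mul_sum_ge h0 h1 hG hpG hθ hn hr2 hr3 hrn z
  have hsq : (C * A * (49 / 100 * θ)) ^ 2 ≤ Vr * (C * (2 * A)) := by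
    have h2 := pow_le_pow_left₀ (by positivity) hE1 2
    rw [neg_sq] at h2
    exact h2.trans (hcs.trans (mul_le_mul_of_nonneg_left hE2 hVr0))
  by_cases hCA : C * A = 0
  · rw [hCA]; simpa using hVr0
  · have hCA' : 0 < C * A := lt_of_le_of_ne (mul_nonneg hC0 hA0) (Ne.symm hCA)
    have : C * A * (2401 / 10000 * (C * A * θ ^ 2)) ≤ C * A * (2 * Vr) := by nlinarith
    have := le_of_mul_le_mul_left this hCA'
    linarith

/-- A lower bound for the variance of the number of non-isolated balls. -/
theorem variance_nonIso_ge (h0 : ∀ b, 0 ≤ p b) (h1 : ∑ v, p v = 1) {G θ : ℝ} (hG : 1 ≤ G)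
    (hpG : ∀ b, n * p b ≤ G) (hθ : ∀ z, θ ≤ (1 - p z) ^ (n - 1)) (hθ0 : 0 < θ) (hθ1 : θ ≤ 1)
    (hn : 400 * G ^ 2 ≤ n * θ) :
    n ^ 2 * (∑ z, p z ^ 2) * θ ^ 2 ≤
      135 * expect p (fun x : Fin n → Fin m => (nonIso x - expect p (nonIso (n := n))) ^ 2) := by
  have hn400 : (400 : ℝ) ≤ n := by
    have a : 1 ≤ G ^ 2 := one_le_pow₀ hG
    have b : n * θ ≤ n * 1 := mul_le_mul_of_nonneg_left hθ1 (Nat.cast_nonneg n)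
    linarith
  have hnn : 400 ≤ n := by exact_mod_cast hn400
  have e2 := choose_mul_sum_far_le h0 h1 hG hpG hθ hθ0 hn (r := 2) le_rfl (by omega) (by omega)
  have e3 := choose_mul_sum_far_le h0 h1 hG hpG hθ hθ0 hn (r := 3) (by omega) le_rfl (by omega)
  have c2 : (n : ℝ) ^ 2 / 3 ≤ n.choose 2 := by
    rw [Nat.cast_choose_two]
    nlinarith
  have c3 : (n : ℝ) ^ 3 / 12 ≤ n.choose 3 := by
    have h3 : (n.choose 3 : ℝ) = n * (n - 1) * (n - 2) / 6 := by
      have hd : (n.choose 3 : ℝ) * 6 = n * (n - 1) * (n - 2) := by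
        have hN : n.choose 3 * 6 = n * (n - 1) * (n - 2) := by
          have := Nat.descFactorial_eq_factorial_mul_choose n 3
          simp [Nat.descFactorial, Nat.factorial] at this
          rw [mul_comm, ← this]; ring
        have hc : ((n.choose 3 * 6 : ℕ) : ℝ) = ((n * (n - 1) * (n - 2) : ℕ) : ℝ) := by rw [hN]
        rw [Nat.cast_mul, Nat.cast_mul, Nat.cast_mul, Nat.cast_sub (by omega),
          Nat.cast_sub (by omega)] at hc
        exact_mod_cast hc
      linarith
    rw [h3]
    have : (n : ℝ) ^ 2 / 2 ≤ (n - 1) * (n - 2) := by nlinarith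
    nlinarith
  set Vr := expect p (fun x : Fin n → Fin m => (nonIso x - expect p (nonIso (n := n))) ^ 2) with hVr
  set A2 := ∑ z, farInd n p 2 z * p z ^ 2 with hA2
  set A3 := ∑ z, farInd n p 3 z * p z ^ 3 with hA3
  have hA20 : 0 ≤ A2 := Finset.sum_nonneg fun z _ =>
    mul_nonneg (farInd_nonneg 2 z) (pow_nonneg (h0 z) 2)
  have hA30 : 0 ≤ A3 := Finset.sum_nonneg fun z _ =>
    mul_nonneg (farInd_nonneg 3 z) (pow_nonneg (h0 z) 3)
  -- If n p_z lies within 1/2 of 2, it is at least 1/2 away from 3, and it exceeds 1, so that (n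
  -- p_z)² ≤ (n p_z)³.
  have hsplit : (n : ℝ) ^ 2 * ∑ z, p z ^ 2 ≤ n ^ 2 * A2 + n ^ 3 * A3 := by
    rw [hA2, hA3, Finset.mul_sum, Finset.mul_sum, Finset.mul_sum, ← Finset.sum_add_distrib]
    refine Finset.sum_le_sum fun z _ => ?_
    have hz : 0 ≤ n * p z := mul_nonneg (Nat.cast_nonneg n) (h0 z)
    have e : ∀ c d : ℝ, (n : ℝ) ^ 2 * (c * p z ^ 2) + n ^ 3 * (d * p z ^ 3) =
        c * (n * p z) ^ 2 + d * (n * p z) ^ 3 := fun c d => by ring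
    rw [e, ← mul_pow]
    have f3 := farInd_nonneg (n := n) (p := p) 3 z
    by_cases hfar : 1 / 2 ≤ |n * p z - (2 : ℕ)|
    · have : farInd n p 2 z = 1 := if_pos hfar
      rw [this]
      have := mul_nonneg f3 (pow_nonneg hz 3)
      linarith
    · have h2 : farInd n p 2 z = 0 := if_neg hfar
      rw [not_le, abs_lt] at hfar
      push_cast at hfar
      have h3 : farInd n p 3 z = 1 := by
        refine if_pos ?_
        push_cast
        rw [abs_of_neg (by linarith)]
        linarith
      rw [h2, h3]
      nlinarith [sq_nonneg (n * p z)]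
  have hθ2 : 0 < θ ^ 2 := by positivity
  -- The constant 135 is 9 · 3 + 9 · 12.
  have g2 : n ^ 2 / 3 * A2 * θ ^ 2 ≤ 9 * Vr := le_trans (by gcongr) e2
  have g3 : n ^ 3 / 12 * A3 * θ ^ 2 ≤ 9 * Vr := le_trans (by gcongr) e3
  have := mul_le_mul_of_nonneg_right hsplit hθ2.le
  linarith

end VarianceLowerBound

/-! ### Transfer between the probability space and the product expectation -/

section Transfer

variable {Ω : Type*} [MeasurableSpace Ω] {P : Measure Ω} [IsProbabilityMeasure P] {n m : ℕ}
  {p : Fin m → ℝ} {X : Fin n → Ω → Fin m}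

lemma integral_eq_expect (hX_meas : ∀ i, Measurable (X i)) (hX_indep : iIndepFun X P)
    (hX_law : ∀ i x, P.real {ω | X i ω = x} = p x) (g : (Fin n → Fin m) → ℝ) :
    ∫ ω, g (fun i => X i ω) ∂P = expect p g := by
  have hm : Measurable (fun ω i => X i ω) := measurable_pi_iff.2 hX_meas
  have := Measure.isProbabilityMeasure_map (μ := P) hm.aemeasurable
  rw [← integral_map (f := g) hm.aemeasurable (measurable_of_countable g).aestronglyMeasurable,
    integral_fintype (Integrable.of_finite)]
  refine Finset.sum_congr rfl fun x _ => ?_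
  rw [smul_eq_mul, map_measureReal_apply hm (measurableSet_singleton x)]
  congr 1
  have e : (fun ω i => X i ω) ⁻¹' {x} = ⋂ i ∈ (Finset.univ : Finset (Fin n)), X i ⁻¹' {x i} := by
    ext ω
    simp [funext_iff]
  rw [e, measureReal_def, hX_indep.measure_inter_preimage_eq_mul Finset.univ
    (fun i _ => measurableSet_singleton (x i)), ENNReal.toReal_prod]
  exact Finset.prod_congr rfl fun i _ => hX_law i (x i)

lemma integral_nonIsolated (hX_meas : ∀ i, Measurable (X i)) (hX_indep : iIndepFun X P)
    (hX_law : ∀ i x, P.real {ω | X i ω = x} = p x) :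
    ∫ ω, nonIsolated X ω ∂P = expect p (nonIso (n := n)) :=
  integral_eq_expect hX_meas hX_indep hX_law nonIso

lemma measurable_nonIsolated (hX_meas : ∀ i, Measurable (X i)) : Measurable (nonIsolated X) :=
  (measurable_of_countable (nonIso (n := n) (m := m))).comp (measurable_pi_iff.2 hX_meas)

lemma variance_nonIsolated (hX_meas : ∀ i, Measurable (X i)) (hX_indep : iIndepFun X P)
    (hX_law : ∀ i x, P.real {ω | X i ω = x} = p x) :
    variance (nonIsolated X) P =
      expect p (fun x : Fin n → Fin m => (nonIso x - expect p (nonIso (n := n))) ^ 2) := by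
  rw [variance_eq_integral (measurable_nonIsolated hX_meas).aemeasurable,
    integral_nonIsolated hX_meas hX_indep hX_law]
  exact integral_eq_expect hX_meas hX_indep hX_law
    (fun x => (nonIso x - expect p (nonIso (n := n))) ^ 2)

lemma measureReal_nonIsolated_le (hX_meas : ∀ i, Measurable (X i)) (hX_indep : iIndepFun X P)
    (hX_law : ∀ i x, P.real {ω | X i ω = x} = p x) (μ σ t : ℝ) :
    P.real {ω | (nonIsolated X ω - μ) / σ ≤ t} =
      expect p (fun x : Fin n → Fin m => if (nonIso x - μ) / σ ≤ t then 1 else 0) := by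
  have hms : MeasurableSet {ω | (nonIsolated X ω - μ) / σ ≤ t} :=
    measurableSet_le (((measurable_nonIsolated hX_meas).sub_const μ).div_const σ) measurable_const
  rw [← integral_indicator_one hms, ← integral_eq_expect hX_meas hX_indep hX_law]
  rfl

/-- Needed because a real supremum over an unbounded family has the default value 0 and would then
bound nothing. -/
lemma kolmogorov_bddAbove (W : Ω → ℝ) (s : ℝ) :
    BddAbove (Set.range fun t : ℝ =>
      |P.real {ω | (W ω - ∫ ω', W ω' ∂P) / s ≤ t} - cdf (gaussianReal 0 1) t|) := by
  refine ⟨1, ?_⟩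
  rintro _ ⟨t, rfl⟩
  have a := measureReal_nonneg (μ := P) (s := {ω | (W ω - ∫ ω', W ω' ∂P) / s ≤ t})
  have b := measureReal_le_one (μ := P) (s := {ω | (W ω - ∫ ω', W ω' ∂P) / s ≤ t})
  have c := cdf_nonneg (gaussianReal 0 1) t
  have d := cdf_le_one (gaussianReal 0 1) t
  simp only
  rw [abs_le]
  constructor <;> linarith

lemma le_kolmogorovDist (W : Ω → ℝ) (t : ℝ) :
    |P.real {ω | (W ω - ∫ ω', W ω' ∂P) / stdDev W P ≤ t} - cdf (gaussianReal 0 1) t| ≤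
      kolmogorovDist W P :=
  le_ciSup (kolmogorov_bddAbove W _) t

end Transfer

/-! ### Lower bound from the lattice structure -/

section LowerBound

open Real

lemma expect_pos_of_ne {ι α : Type*} [Fintype ι] [DecidableEq ι] [Fintype α] [DecidableEq α]
    {p : α → ℝ} (hp : ∀ v, 0 < p v) {g : (ι → α) → ℝ} (x y : ι → α) (hxy : g x ≠ g y) (c : ℝ) :
    0 < expect p (fun x => (g x - c) ^ 2) := by
  have hw : ∀ x : ι → α, 0 < ∏ i, p (x i) := fun x => Finset.prod_pos fun i _ => hp _
  refine Finset.sum_pos' (fun z _ => mul_nonneg (hw z).le (sq_nonneg _)) ?_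
  by_cases hx : g x = c
  · exact ⟨y, Finset.mem_univ y, mul_pos (hw y)
      (sq_pos_of_ne_zero (fun h => hxy (by rw [hx, sub_eq_zero.1 h])))⟩
  · exact ⟨x, Finset.mem_univ x, mul_pos (hw x) (sq_pos_of_ne_zero (sub_ne_zero.2 hx))⟩

/-- Starting with all balls in one urn, moving a single ball to an empty urn isolates it and changes
the count. -/
lemma exists_nonIso_ne {n m : ℕ} (hn : 2 ≤ n) (hm : 2 ≤ m) :
    ∃ x y : Fin n → Fin m, nonIso x ≠ nonIso y := by
  let i : Fin n := ⟨0, by omega⟩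
  let j : Fin n := ⟨1, by omega⟩
  let a : Fin m := ⟨0, by omega⟩
  let b : Fin m := ⟨1, by omega⟩
  have hab : a ≠ b := by simp [a, b]
  have hji : j ≠ i := by simp [i, j]
  refine ⟨update (fun _ => a) i b, fun _ => a, sub_ne_zero.1 ?_⟩
  rw [nonIso_update_sub]
  have h0 : others (fun _ : Fin n => a) i b = 0 := by
    simp [others, hab]
  have h1 : 0 < others (fun _ : Fin n => a) i a :=
    Finset.card_pos.2 ⟨j, by simpa using hji⟩
  obtain ⟨k, hk⟩ : ∃ k, others (fun _ : Fin n => a) i a = k + 1 := ⟨_, (Nat.succ_pred h1.ne').symm⟩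
  rw [h0, hk]
  unfold urnStep urnValue
  rcases k with _ | k <;> norm_num

lemma cdf_increment_ge {a b : ℝ} (ha : -1 ≤ a) (hab : a ≤ b) (hb : b ≤ 1) :
    (b - a) * ((√(2 * π))⁻¹ * exp (-(1 / 2))) ≤
      cdf (gaussianReal 0 1) b - cdf (gaussianReal 0 1) a := by
  rw [cdf_sub_cdf]
  have : ∫ _u in a..b, (√(2 * π))⁻¹ * exp (-(1 / 2)) ≤
      ∫ u in a..b, (√(2 * π))⁻¹ * exp (-u ^ 2 / 2) := by
    refine intervalIntegral.integral_mono_on hab (by simp)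
      (Continuous.intervalIntegrable (by fun_prop) _ _) fun u hu => ?_
    refine mul_le_mul_of_nonneg_left (exp_le_exp.2 ?_) (by positivity)
    nlinarith [hu.1, hu.2]
  rwa [intervalIntegral.integral_const, smul_eq_mul] at this

/-- Here exp(-u²/2) ≥ (1 - u²/4)². With v = -c(c + 1) ≥ 0 the integral of this polynomial is 5/6 +
1/80 plus nonnegative terms in v, and 0.84/2.51 > 1/3. -/
lemma cdf_unit_increment_ge {c : ℝ} (h1 : -1 ≤ c) (h0 : c ≤ 0) :
    1 / 3 ≤ cdf (gaussianReal 0 1) (c + 1) - cdf (gaussianReal 0 1) c := by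
  rw [cdf_sub_cdf, intervalIntegral.integral_const_mul]
  have hle : ∫ u in c..(c + 1), (1 - u ^ 2 / 2 + u ^ 4 / 16) ≤
      ∫ u in c..(c + 1), exp (-u ^ 2 / 2) := by
    refine intervalIntegral.integral_mono_on (by linarith)
      (Continuous.intervalIntegrable (by fun_prop) _ _)
      (Continuous.intervalIntegrable (by fun_prop) _ _) fun u hu => ?_
    have e : exp (-u ^ 2 / 2) = exp (-u ^ 2 / 4) ^ 2 := by
      rw [← exp_nat_mul]; congr 1; push_cast; ring
    have i1 := add_one_le_exp (-u ^ 2 / 4)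
    have i2 : 0 ≤ -u ^ 2 / 4 + 1 := by nlinarith [hu.1, hu.2]
    rw [e]
    calc _ = (-u ^ 2 / 4 + 1) ^ 2 := by ring
      _ ≤ _ := pow_le_pow_left₀ i2 i1 2
  have hint : ∫ u in c..(c + 1), (1 - u ^ 2 / 2 + u ^ 4 / 16) =
      1 - ((c + 1) ^ 3 - c ^ 3) / 6 + ((c + 1) ^ 5 - c ^ 5) / 80 := by
    have hd : ∀ u ∈ Set.uIcc c (c + 1), HasDerivAt (fun u : ℝ => u - u ^ 3 / 6 + u ^ 5 / 80)
        (1 - u ^ 2 / 2 + u ^ 4 / 16) u := by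
      intro u _
      exact (((hasDerivAt_id u).sub ((hasDerivAt_pow 3 u).div_const 6)).add
        ((hasDerivAt_pow 5 u).div_const 80)).congr_deriv (by norm_num; ring)
    rw [intervalIntegral.integral_eq_sub_of_hasDerivAt hd
      (Continuous.intervalIntegrable (by fun_prop) _ _)]
    ring
  rw [hint] at hle
  have hpoly : 0.84 ≤ 1 - ((c + 1) ^ 3 - c ^ 3) / 6 + ((c + 1) ^ 5 - c ^ 5) / 80 := by
    have hv : 0 ≤ -c * (c + 1) := mul_nonneg (by linarith) (by linarith)
    nlinarith [mul_nonneg hv hv]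
  have hs : 0 < √(2 * π) := by have := two_le_sqrt_two_pi; positivity
  rw [inv_mul_eq_div, le_div_iff₀ hs]
  have := sqrt_two_pi_le
  linarith

lemma rpow_const_eq : (8 * π * exp 1) ^ (-(1 / 2) : ℝ) = (√(2 * π))⁻¹ * exp (-(1 / 2)) / 2 := by
  rw [rpow_neg (by positivity), ← sqrt_eq_rpow]
  have e : 8 * π * exp 1 = (√(2 * π) * exp (1 / 2) * 2) ^ 2 := by
    rw [mul_pow, mul_pow, sq_sqrt (by positivity), ← exp_nat_mul]
    norm_num
    ring
  rw [e, sqrt_sq (by positivity), exp_neg, mul_inv, mul_inv]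
  ring

/-- The Kolmogorov distance of an integer-valued variable to the normal law is bounded below. -/
theorem min_le_of_kolmogorov {ι α : Type*} [Fintype ι] [DecidableEq ι] [Fintype α] [DecidableEq α]
    {p : α → ℝ} (Y : (ι → α) → ℝ) (hY : ∀ x, ∃ k : ℤ, Y x = k) (μ σ D : ℝ) (hσ : 0 < σ)
    (hD : ∀ t, |expect p (fun x => if (Y x - μ) / σ ≤ t then 1 else 0) -
      cdf (gaussianReal 0 1) t| ≤ D) :
    min (1 / 6) ((8 * π * exp 1) ^ (-(1 / 2) : ℝ) * σ⁻¹) ≤ D := by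
  set F : ℝ → ℝ := fun t => expect p (fun x => if (Y x - μ) / σ ≤ t then 1 else 0) with hF
  have hconst : ∀ (k : ℤ) (t : ℝ), (k - μ) / σ ≤ t → t < (k + 1 - μ) / σ →
      F t = F ((k - μ) / σ) := by
    intro k t h1 h2
    simp only [hF]
    congr 1
    funext x
    obtain ⟨l, hl⟩ := hY x
    rw [hl]
    have : ((l : ℝ) - μ) / σ ≤ t ↔ ((l : ℝ) - μ) / σ ≤ (k - μ) / σ := by
      refine ⟨fun h => ?_, fun h => h.trans h1⟩
      have h3 := lt_of_le_of_lt h h2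
      rw [div_lt_div_iff_of_pos_right hσ] at h3
      have h4 : (l : ℝ) < ((k + 1 : ℤ) : ℝ) := by push_cast; linarith
      have h5 : l ≤ k := Int.lt_add_one_iff.1 (by exact_mod_cast h4)
      have h6 : (l : ℝ) ≤ k := by exact_mod_cast h5
      gcongr
    simp only [this]
  -- F is constant on the half-open cell, so D controls Φ against one and the same value at the left
  -- end and just before the right end.
  have hgap : ∀ k : ℤ, cdf (gaussianReal 0 1) ((k + 1 - μ) / σ) -
      cdf (gaussianReal 0 1) ((k - μ) / σ) ≤ 2 * D := by
    intro k
    have hlt : ((k : ℝ) - μ) / σ < (k + 1 - μ) / σ := by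
      rw [div_lt_div_iff_of_pos_right hσ]; linarith
    refine le_of_forall_pos_le_add fun e he => ?_
    set t := max ((k - μ) / σ) ((k + 1 - μ) / σ - e) with ht
    have t1 : (k - μ) / σ ≤ t := le_max_left _ _
    have t2 : t < (k + 1 - μ) / σ := max_lt hlt (by linarith)
    have t3 : (k + 1 - μ) / σ - e ≤ t := le_max_right _ _
    have hc := hconst k t t1 t2
    have d1 := (abs_le.1 (hD t)).1
    have d2 := (abs_le.1 (hD ((k - μ) / σ))).2
    have d3 := cdf_sub_cdf_le t2.le
    simp only [hF] at hc
    linarith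
  -- For σ ≥ 1 a whole cell fits into [-1, 1], where the density is at least its value at 1. For σ <
  -- 1 the cell containing the origin has length above 1 and contains a unit interval starting in
  -- [-1, 0].
  by_cases hσ1 : 1 ≤ σ
  · refine (min_le_right _ _).trans ?_
    have c1 := Int.le_ceil (μ - σ)
    have c2 := Int.ceil_lt_add_one (μ - σ)
    set k := ⌈μ - σ⌉
    have b1 : -1 ≤ (k - μ) / σ := by rw [le_div_iff₀ hσ]; linarith
    have b2 : (k + 1 - μ) / σ ≤ 1 := by rw [div_le_one hσ]; linarith
    have b3 : (k - μ) / σ ≤ (k + 1 - μ) / σ := by gcongr; linarith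
    have h := (cdf_increment_ge b1 b3 b2).trans (hgap k)
    have e : (k + 1 - μ) / σ - (k - μ) / σ = σ⁻¹ := by field_simp; ring
    rw [e] at h
    rw [rpow_const_eq]
    linarith
  · refine (min_le_left _ _).trans ?_
    push Not at hσ1
    have c1 := Int.floor_le μ
    have c2 := Int.lt_floor_add_one μ
    set k := ⌊μ⌋
    have b1 : (k - μ) / σ ≤ 0 := div_nonpos_of_nonpos_of_nonneg (by linarith) hσ.le
    have b2 : 0 ≤ (k + 1 - μ) / σ := div_nonneg (by linarith) hσ.le
    have b3 : (k - μ) / σ + 1 ≤ (k + 1 - μ) / σ := by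
      rw [div_add_one hσ.ne']
      gcongr
      linarith
    set c := max ((k - μ) / σ) (-1) with hc
    have hcu : c + 1 ≤ (k + 1 - μ) / σ := by
      have : c ≤ (k + 1 - μ) / σ - 1 := max_le (by linarith) (by linarith)
      linarith
    have h := cdf_unit_increment_ge (le_max_right _ _ : -1 ≤ c) (max_le b1 (by norm_num))
    have m1 := monotone_cdf (gaussianReal 0 1) hcu
    have m2 := monotone_cdf (gaussianReal 0 1) (le_max_left _ _ : (k - μ) / σ ≤ c)
    have := hgap k
    linarith

end LowerBound

/-! ### Upper bound on the product space -/

section UpperBound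

open Real

/-- The quadratic Taylor bound for exp(1.05 q), multiplied by 1 - q, stays at least 1; the rate 1.05
leaves almost no room at q = 1/11. -/
lemma exp_neg_le_one_sub {q : ℝ} (h0 : 0 ≤ q) (h1 : q ≤ 1 / 11) : exp (-(1.05 * q)) ≤ 1 - q := by
  rw [exp_neg, inv_le_iff_one_le_mul₀ (exp_pos _)]
  have h := quadratic_le_exp_of_nonneg (show 0 ≤ 1.05 * q by positivity)
  have h2 : (1 - q) * (1 + 1.05 * q + (1.05 * q) ^ 2 / 2) ≤ (1 - q) * exp (1.05 * q) :=
    mul_le_mul_of_nonneg_left h (by linarith)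
  nlinarith [mul_nonneg h0 (sub_nonneg.2 h1), mul_nonneg (mul_nonneg h0 h0) (sub_nonneg.2 h1)]

lemma exp_neg_le_one_sub_pow {n : ℕ} {q G : ℝ} (h0 : 0 ≤ q) (h1 : q ≤ 1 / 11) (hG : n * q ≤ G) :
    exp (-(1.05 * G)) ≤ (1 - q) ^ (n - 1) := by
  calc exp (-(1.05 * G)) ≤ exp (n * -(1.05 * q)) := exp_le_exp.2 (by nlinarith)
    _ = exp (-(1.05 * q)) ^ n := exp_nat_mul _ _
    _ ≤ (1 - q) ^ n := pow_le_pow_left₀ (exp_pos _).le (exp_neg_le_one_sub h0 h1) n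
    _ ≤ (1 - q) ^ (n - 1) :=
        pow_le_pow_of_le_one (by linarith) (by linarith) (Nat.sub_le n 1)

/-- The Kolmogorov bound for the number of non-isolated balls on the canonical space. -/
theorem kolmogorov_nonIso_le {n m : ℕ} {p : Fin m → ℝ} (h0 : ∀ b, 0 ≤ p b) (h1 : ∑ v, p v = 1)
    {G σ D : ℝ} (hG : 1 ≤ G) (hpG : ∀ b, n * p b ≤ G) (hp11 : ∀ b, p b ≤ 1 / 11)
    (hn : 83 * G ^ 2 * (1 + 3 * G + 3 * G ^ 2) * exp (1.05 * G) ≤ n) (hσ : 0 < σ)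
    (hvar : expect p (fun x : Fin n → Fin m => (nonIso x - expect p (nonIso (n := n))) ^ 2) = σ ^ 2)
    (hD : ∀ t, |expect p (fun x : Fin n → Fin m =>
      if (nonIso x - expect p (nonIso (n := n))) / σ ≤ t then 1 else 0) -
        cdf (gaussianReal 0 1) t| ≤ D) (t : ℝ) :
    |expect p (fun x : Fin n → Fin m =>
      if (nonIso x - expect p (nonIso (n := n))) / σ ≤ t then 1 else 0) -
        cdf (gaussianReal 0 1) t| ≤ D / 2 + 17402 * G ^ 2 * exp (2.1 * G) * σ⁻¹ := by
  set lam : ℝ := n ^ 2 * ∑ b, p b ^ 2 with hlam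
  set E := exp (2.1 * G) with hE
  have hE1 : 1 ≤ E := one_le_exp (by positivity)
  have hG2 : 1 ≤ G ^ 2 := one_le_pow₀ hG
  have hθ1 : exp (-(1.05 * G)) ≤ 1 := exp_le_one_iff.2 (by linarith)
  -- As G ≥ 1, the hypothesis gives at least 83 · 7 G² after multiplication by exp(-1.05 G).
  have hnθ : 400 * G ^ 2 ≤ n * exp (-(1.05 * G)) := by
    have e : exp (1.05 * G) * exp (-(1.05 * G)) = 1 := by rw [← exp_add]; simp
    have h := mul_le_mul_of_nonneg_right hn (exp_pos (-(1.05 * G))).le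
    rw [mul_assoc _ (exp _), e, mul_one] at h
    refine le_trans ?_ h
    nlinarith
  have hvl := variance_nonIso_ge h0 h1 hG hpG
    (fun z => exp_neg_le_one_sub_pow (h0 z) (hp11 z) (hpG z)) (exp_pos _) hθ1 hnθ
  rw [hvar, ← hlam] at hvl
  have hlamL : lam ≤ 135 * E * σ ^ 2 := by
    have e : exp (-(1.05 * G)) ^ 2 * E = 1 := by
      rw [hE, ← exp_nat_mul, ← exp_add, exp_eq_one_iff]; push_cast; ring
    have h := mul_le_mul_of_nonneg_right hvl (by positivity : 0 ≤ E)
    rw [mul_assoc, e] at h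
    linarith
  have hdrift := variance_driftSum_le h0 h1 hG hpG
  rw [expect_driftSum h1, hvar, ← hlam] at hdrift
  have hp1 : ∀ b, p b ≤ 1 := fun b => (hp11 b).trans (by norm_num)
  have hmain := kolmogorov_le_of_increments h0 h1 nonIso (expect p (nonIso (n := n))) σ (135 * E)
    (2432 * G ^ 3 * lam) D hσ (by positivity) hvar (weight p)
    (fun k x => nonIso (before k x)) (fun k x => nonIso (after k x))
    (expect_nonIso_sub_mul h1) (weight_nonneg h0 hp1)
    (fun x => (sum_weight_le h0 hp1 x).trans (by rw [← hlam]; linarith))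
    (fun k x => (abs_before_sub_le k x).trans (by norm_num)) abs_after_sub_le
    abs_after_sub_before_le hdrift hD t
  refine hmain.trans (add_le_add le_rfl ?_)
  -- Here 2432 · 135 = 328320 is below 600².
  have hV : √(2432 * G ^ 3 * lam) ≤ 600 * G ^ 2 * E * σ := by
    apply sqrt_le_iff.2
    refine ⟨by positivity, ?_⟩
    calc 2432 * G ^ 3 * lam ≤ 2432 * G ^ 3 * (135 * E * σ ^ 2) := by gcongr
      _ = 328320 * G ^ 3 * E * σ ^ 2 := by ring
      _ ≤ 360000 * G ^ 4 * E ^ 2 * σ ^ 2 := by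
          have i1 : G ^ 3 ≤ G ^ 4 := pow_le_pow_right₀ hG (by norm_num)
          have i2 : E ≤ E ^ 2 := by nlinarith
          gcongr
          norm_num
      _ = _ := by ring
  have hfrac : 2 * √(2432 * G ^ 3 * lam) / σ ^ 2 ≤ 1200 * G ^ 2 * E * σ⁻¹ := by
    calc _ ≤ 2 * (600 * G ^ 2 * E * σ) / σ ^ 2 := by gcongr
      _ = _ := by field_simp; ring
  have hrest : (120 * (135 * E) + 3 / 2) / σ ≤ 16202 * G ^ 2 * E * σ⁻¹ := by
    rw [div_eq_mul_inv]
    refine mul_le_mul_of_nonneg_right ?_ (by positivity)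
    nlinarith
  linarith

end UpperBound

end UrnModel

end

/-! ### Assembly of the three claims -/

theorem theorem2p3 {Ω : Type*} [MeasurableSpace Ω] (P : Measure Ω) [IsProbabilityMeasure P]
    (n m : ℕ) (hn : 2 ≤ n) (hm : 4 ≤ m)
    (p : Fin m → ℝ) (hp_pos : ∀ x, 0 < p x) (hp_sum : ∑ x, p x = 1)
    (X : Fin n → Ω → Fin m) (hX_meas : ∀ i, Measurable (X i))
    (hX_indep : iIndepFun X P) (hX_law : ∀ i x, P.real {ω | X i ω = x} = p x) :
    0 < UrnModel.stdDev (UrnModel.nonIsolated X) P ∧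
    min (1 / 6)
        ((8 * Real.pi * Real.exp 1) ^ (-(1 / 2) : ℝ) *
          (UrnModel.stdDev (UrnModel.nonIsolated X) P)⁻¹)
      ≤ UrnModel.kolmogorovDist (UrnModel.nonIsolated X) P ∧
    (UrnModel.maxProb p ≤ 1 / 11 →
      83 * UrnModel.gam n p ^ 2 * (1 + 3 * UrnModel.gam n p + 3 * UrnModel.gam n p ^ 2) *
          Real.exp (1.05 * UrnModel.gam n p) ≤ (n : ℝ) →
      UrnModel.kolmogorovDist (UrnModel.nonIsolated X) P ≤
        8165 * UrnModel.gam n p ^ 2 * Real.exp (2.1 * UrnModel.gam n p) *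
          (577 + 23 * UrnModel.Cfun (UrnModel.gam n p)) *
          (UrnModel.stdDev (UrnModel.nonIsolated X) P)⁻¹) := by
  open UrnModel in
  have hvar := variance_nonIsolated hX_meas hX_indep hX_law
  have hpos : 0 < variance (nonIsolated X) P := by
    obtain ⟨x, y, hxy⟩ := exists_nonIso_ne hn (by omega : 2 ≤ m)
    rw [hvar]
    exact expect_pos_of_ne hp_pos x y hxy _
  have hσ : 0 < stdDev (nonIsolated X) P := Real.sqrt_pos.2 hpos
  have hσ2 : stdDev (nonIsolated X) P ^ 2 = variance (nonIsolated X) P := Real.sq_sqrt hpos.le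
  have hD := le_kolmogorovDist (P := P) (nonIsolated X)
  simp only [measureReal_nonIsolated_le hX_meas hX_indep hX_law,
    integral_nonIsolated hX_meas hX_indep hX_law] at hD
  refine ⟨hσ, ?_, ?_⟩
  · refine min_le_of_kolmogorov nonIso (fun x => ?_) _ _ _ hσ hD
    refine ⟨∑ i, if 0 < companions x i then 1 else 0, ?_⟩
    rw [nonIso]
    push_cast
    rfl
  · intro hmax hnG
    have hple : ∀ b, p b ≤ maxProb p := le_ciSup (Set.finite_range p).bddAbove
    have hG : 1 ≤ gam n p := le_max_right _ _
    have hpG : ∀ b, n * p b ≤ gam n p := fun b =>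
      (mul_le_mul_of_nonneg_left (hple b) (Nat.cast_nonneg n)).trans (le_max_left _ _)
    have h := kolmogorov_nonIso_le (fun b => (hp_pos b).le) hp_sum hG hpG
      (fun b => (hple b).trans hmax) hnG hσ (by rw [hσ2, hvar]) hD
    -- The pointwise bound already contains half the supremum; taking the supremum over t allows
    -- that half to be absorbed.
    have hsup : kolmogorovDist (nonIsolated X) P ≤ kolmogorovDist (nonIsolated X) P / 2 +
        17402 * gam n p ^ 2 * Real.exp (2.1 * gam n p) * (stdDev (nonIsolated X) P)⁻¹ := by
      refine ciSup_le fun t => ?_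
      rw [measureReal_nonIsolated_le hX_meas hX_indep hX_law,
        integral_nonIsolated hX_meas hX_indep hX_law]
      exact h t
    have hC : 0 ≤ Cfun (gam n p) := by unfold Cfun; positivity
    -- The constant obtained is much smaller than the claimed one: 34804 < 8165 · 577, so only C(γ)
    -- ≥ 0 is needed.
    calc kolmogorovDist (nonIsolated X) P
        ≤ 34804 * (gam n p ^ 2 * Real.exp (2.1 * gam n p) * (stdDev (nonIsolated X) P)⁻¹) := by
          linarith
      _ ≤ 8165 * (577 + 23 * Cfun (gam n p)) *
          (gam n p ^ 2 * Real.exp (2.1 * gam n p) * (stdDev (nonIsolated X) P)⁻¹) :=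
          mul_le_mul_of_nonneg_right (by linarith) (by positivity)
      _ = _ := by ring
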